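/- Let $P=-i\,d/dx$ and $Q$ (multiplication by $x$) be the momentum and position operators on $L^2(\mathbb R)$, with domain the space $\mathcal D$ of Schwartz functions. For $a,b\in\mathbb R$ and $c\in\mathbb R\setminus\{0\}$ let $R(a,b,c)=(ic+aP+bQ)^{-1}$ be the inverse of $ic+\overline{(aP+bQ)|_{\mathcal D}}$ (bar: closure), and let $\mathcal R$ be the C*-algebra of bounded operators on $L^2(\mathbb R)$ generated by all the $R(a,b,c)$. For $m>0$ let $H_m=(P^2+m^2)^{1/2}$; likewise $(ic+Q+tP(P^2+m^2)^{-1/2})^{-1}$ is the inverse of $ic$ plus the closure of $Q+tP(P^2+m^2)^{-1/2}$ on $\mathcal D$. Bounded functions of $P$ are defined by multiplication in momentum space. For $\delta>0$ let $D(\delta)$ be the unitary dilation $(D(\delta)f)(x)=\delta^{-1/2}f(x/\delta)$. All limits are in the strong operator topology. 1. For all $a,b\in\mathbb R$, $c\neq0$, the operator $R(a,b,c)$ exists as an everywhere defined bounded two-sided inverse, and $$\lim_{\delta\to\infty}D(\delta)\,R(a,b,c)\,D(\delta)^{-1}=\begin{cases}(ic)^{-1}1,& a=0,\\ 0,& a\neq0.\end{cases}$$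 For every $A\in\mathcal R$ the limit $\lim_{\delta\to\infty}D(\delta)AD(\delta)^{-1}$ exists and is a scalar multiple of $1$. 2. For all $m>0$, $t\in\mathbb R$, $c\neq0$, the operator $(ic+Q+tP(P^2+m^2)^{-1/2})^{-1}$ exists as an everywhere defined bounded two-sided inverse, the bounded operator $ic+tP/|P|$ is invertible, and $$\lim_{\delta\to\infty}D(\delta)\,(ic+Q+tP(P^2+m^2)^{-1/2})^{-1}D(\delta)^{-1}=(ic+tP/|P|)^{-1}.$$ If $t\neq0$, this limit is not a scalar multiple of $1$. 3. For all $m>0$, $t\in\mathbb R$, $c\neq0$, $$e^{itH_m}(ic+Q)^{-1}e^{-itH_m}=(ic+Q+tP(P^2+m^2)^{-1/2})^{-1},$$ and for $t\neq0$ this operator is not in $\mathcal R$. Hence for every $m>0$ and $t\neq0$ there is an $A\in\mathcal R$ with $e^{itH_m}Ae^{-itH_m}\notin\mathcal R$. -/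

import Mathlib

open MeasureTheory Filter Topology SchwartzMap FourierTransform

namespace ResolventAlgebra

noncomputable section

/-- The Hilbert space `L²(ℝ)` of the Schrödinger representation (one degree of freedom). -/
abbrev H : Type := Lp ℂ 2 (volume : Measure ℝ)

/-! ### Position and momentum on Schwartz functions -/

/-- The domain `𝓓 ⊆ L²(ℝ)`: the (classes of) Schwartz test functions. -/
def schwartzDomain : Submodule ℂ H :=
  LinearMap.range (toLpCLM ℂ ℂ 2 (volume : Measure ℝ)).toLinearMap

/-- Schwartz functions as a subspace of `L²(ℝ)`. -/
def schwartzEquiv : 𝓢(ℝ, ℂ) ≃ₗ[ℂ] schwartzDomain :=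
  LinearEquiv.ofInjective (toLpCLM ℂ ℂ 2 (volume : Measure ℝ)).toLinearMap
    (injective_toLp 2 (volume : Measure ℝ))

/-- The operator in `L²(ℝ)` with domain `𝓓` given by a linear map of the Schwartz space. -/
def onSchwartz (A : 𝓢(ℝ, ℂ) →L[ℂ] 𝓢(ℝ, ℂ)) : H →ₗ.[ℂ] H where
  domain := schwartzDomain
  toFun := (toLpCLM ℂ ℂ 2 (volume : Measure ℝ)).toLinearMap ∘ₗ A.toLinearMap ∘ₗ
    schwartzEquiv.symm.toLinearMap

/-- The position operator `Q`, `(Q f)(x) = x f(x)`, on `𝓓`. -/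
def opQ : H →ₗ.[ℂ] H :=
  onSchwartz (smulLeftCLM ℂ (fun x : ℝ => (x : ℂ)))

/-- The momentum operator `P`, `(P f)(x) = -i f'(x)`, on `𝓓`. -/
def opP : H →ₗ.[ℂ] H :=
  onSchwartz (-Complex.I • derivCLM ℂ ℂ)

/-! ### Inverses of unbounded operators, resolvents, and the resolvent algebra -/

/-- `R` is the everywhere defined, bounded, two-sided inverse of the unbounded operator `S`. -/
def IsBoundedInverse (S : H →ₗ.[ℂ] H) (R : H →L[ℂ] H) : Prop :=
  (∀ ψ : S.domain, R (S ψ) = ψ) ∧ ∀ φ : H, ∃ h : R φ ∈ S.domain, S ⟨R φ, h⟩ = φ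

open scoped Classical in
/-- The bounded inverse of an unbounded operator (`0` if there is none). -/
def boundedInverse (S : H →ₗ.[ℂ] H) : H →L[ℂ] H :=
  if h : ∃ R, IsBoundedInverse S R then h.choose else 0

/-- `i c + T̄`, where `T̄` is the closure of `T`. -/
def shiftedClosure (c : ℝ) (T : H →ₗ.[ℂ] H) : H →ₗ.[ℂ] H :=
  ((Complex.I * (c : ℂ)) • (LinearMap.id : H →ₗ[ℂ] H)) +ᵥ T.closure

/-- `a P + b Q` on `𝓓`. -/
def linComb (a b : ℝ) : H →ₗ.[ℂ] H := (a : ℂ) • opP + (b : ℂ) • opQ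

/-- The basic resolvent `R(a, b, c) = (i c + a P + b Q)⁻¹`. -/
def basicResolvent (a b c : ℝ) : H →L[ℂ] H :=
  boundedInverse (shiftedClosure c (linComb a b))

/-- The resolvent algebra: the C*-subalgebra of `B(L²(ℝ))` generated by all `R(a, b, c)` with
`a, b ∈ ℝ` and `c ∈ ℝ \ {0}`. (It is unital, as `R(0, 0, c) = (i c)⁻¹ 1`.) -/
def resolventAlgebra : StarSubalgebra ℂ (H →L[ℂ] H) :=
  (StarAlgebra.adjoin ℂ
    {R : H →L[ℂ] H | ∃ a b c : ℝ, c ≠ 0 ∧ R = basicResolvent a b c}).topologicalClosure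

/-! ### Bounded functions of the momentum operator -/

/-- Multiplication by an essentially bounded function `g` on `L²(ℝ)`. -/
def mulOp (g : ℝ → ℂ) (hg : MemLp g ⊤ (volume : Measure ℝ)) : H →L[ℂ] H :=
  (ContinuousLinearMap.mul ℂ ℂ).holderL (volume : Measure ℝ) ⊤ 2 2 (hg.toLp g)

theorem memLp_scaled {g : ℝ → ℂ} (hg : Measurable g) {C : ℝ} (hC : ∀ p, ‖g p‖ ≤ C) :
    MemLp (fun ξ : ℝ => g (2 * Real.pi * ξ)) ⊤ (volume : Measure ℝ) :=
  memLp_top_of_bound (hg.comp (measurable_const_mul _)).aestronglyMeasurable C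
    (Eventually.of_forall fun _ => hC _)

/-- The bounded function `g(P)` of the momentum operator: in momentum space it is multiplication
by `g(p)`. (With the Fourier transform `∫ e^{-2πixξ} f(x) dx` used here, `P = -i d/dx` is
multiplication by `p = 2πξ`.) -/
def funP (g : ℝ → ℂ) (hg : Measurable g) {C : ℝ} (hC : ∀ p, ‖g p‖ ≤ C) : H →L[ℂ] H :=
  (Lp.fourierTransformₗᵢ ℝ ℂ).symm.toContinuousLinearEquiv.toContinuousLinearMap ∘L
    mulOp (fun ξ => g (2 * Real.pi * ξ)) (memLp_scaled hg hC) ∘L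
    (Lp.fourierTransformₗᵢ ℝ ℂ).toContinuousLinearEquiv.toContinuousLinearMap

theorem norm_velocity_le (m p : ℝ) : ‖((p / Real.sqrt (p ^ 2 + m ^ 2) : ℝ) : ℂ)‖ ≤ 1 := by
  rw [Complex.norm_real, Real.norm_eq_abs, abs_div, abs_of_nonneg (Real.sqrt_nonneg _)]
  exact div_le_one_of_le₀ (Real.abs_le_sqrt (by nlinarith [sq_nonneg m])) (Real.sqrt_nonneg _)

/-- The relativistic velocity `P (P² + m²)^{-1/2}`. -/
def velocity (m : ℝ) : H →L[ℂ] H :=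
  funP (fun p => ((p / Real.sqrt (p ^ 2 + m ^ 2) : ℝ) : ℂ)) (by fun_prop) (norm_velocity_le m)

theorem norm_signum_le (p : ℝ) : ‖((p / |p| : ℝ) : ℂ)‖ ≤ 1 := by
  rw [Complex.norm_real, Real.norm_eq_abs, abs_div, abs_abs]
  exact div_self_le_one _

/-- `P / |P|`. -/
def signP : H →L[ℂ] H :=
  funP (fun p => ((p / |p| : ℝ) : ℂ)) (by fun_prop) norm_signum_le

theorem norm_phase_le (t m p : ℝ) :
    ‖Complex.exp (((t * Real.sqrt (p ^ 2 + m ^ 2) : ℝ) : ℂ) * Complex.I)‖ ≤ 1 :=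
  (Complex.norm_exp_ofReal_mul_I _).le

/-- `e^{i t H_m}` for the relativistic free Hamiltonian `H_m = (P² + m²)^{1/2}`. -/
def relEvolution (m t : ℝ) : H →L[ℂ] H :=
  funP (fun p => Complex.exp (((t * Real.sqrt (p ^ 2 + m ^ 2) : ℝ) : ℂ) * Complex.I))
    (by fun_prop) (norm_phase_le t m)

/-- `Q + t P (P² + m²)^{-1/2}` on `𝓓`. -/
def boostedQ (m t : ℝ) : H →ₗ.[ℂ] H :=
  ((t : ℂ) • (velocity m).toLinearMap) +ᵥ opQ

/-- `(i c + Q + t P (P² + m²)^{-1/2})⁻¹`. -/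
def evolvedResolvent (m t c : ℝ) : H →L[ℂ] H :=
  boundedInverse (shiftedClosure c (boostedQ m t))

/-- `i c + t P / |P|`, a bounded operator. -/
def limitOp (t c : ℝ) : H →L[ℂ] H :=
  (Complex.I * (c : ℂ)) • (1 : H →L[ℂ] H) + (t : ℂ) • signP

/-! ### Dilations -/

theorem memLp_dilation {δ : ℝ} (hδ : 0 < δ) (f : H) :
    MemLp (fun x : ℝ => f (δ⁻¹ * x)) 2 (volume : Measure ℝ) := by
  have h0 : δ⁻¹ ≠ 0 := (inv_pos.2 hδ).ne'
  have hf : MemLp f 2 (Measure.map (fun x : ℝ => δ⁻¹ * x) volume) := by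
    rw [Real.map_volume_mul_left h0]
    exact (Lp.memLp f).smul_measure ENNReal.ofReal_ne_top
  exact hf.comp_of_map (measurable_const_mul _).aemeasurable

theorem ae_dilation {δ : ℝ} (hδ : 0 < δ) {p : ℝ → Prop} (h : ∀ᵐ x ∂(volume : Measure ℝ), p x) :
    ∀ᵐ x ∂(volume : Measure ℝ), p (δ⁻¹ * x) := by
  have h0 : δ⁻¹ ≠ 0 := (inv_pos.2 hδ).ne'
  have hq : Measure.QuasiMeasurePreserving (fun x : ℝ => δ⁻¹ * x) volume volume := by
    refine ⟨measurable_const_mul _, ?_⟩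
    rw [Real.map_volume_mul_left h0]
    exact Measure.smul_absolutelyContinuous
  exact hq.ae h

/-- `f ↦ δ^{-1/2} f(x / δ)` as a linear map of `L²(ℝ)`. -/
def dilationLin (δ : Set.Ioi (0 : ℝ)) : H →ₗ[ℂ] H where
  toFun f := (((Real.sqrt δ.1)⁻¹ : ℝ) : ℂ) • (memLp_dilation δ.2 f).toLp _
  map_add' f g := by
    rw [← smul_add, ← MemLp.toLp_add]
    congr 1
    exact MemLp.toLp_congr _ _ (ae_dilation δ.2 (Lp.coeFn_add f g))
  map_smul' c f := by
    have key : (memLp_dilation δ.2 (c • f)).toLp _ = c • (memLp_dilation δ.2 f).toLp _ := by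
      rw [← MemLp.toLp_const_smul]
      exact MemLp.toLp_congr _ _ (ae_dilation δ.2 (p := fun x => (c • f : H) x = (c • ⇑f) x)
        (Lp.coeFn_smul c f))
    rw [key, RingHom.id_apply, smul_comm c]

theorem coeFn_dilationLin (δ : Set.Ioi (0 : ℝ)) (f : H) :
    dilationLin δ f =ᵐ[volume] fun x => (((Real.sqrt δ.1)⁻¹ : ℝ) : ℂ) * f (δ.1⁻¹ * x) := by
  filter_upwards [Lp.coeFn_smul (((Real.sqrt δ.1)⁻¹ : ℝ) : ℂ) ((memLp_dilation δ.2 f).toLp _),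
    (memLp_dilation δ.2 f).coeFn_toLp] with x h1 h2
  change ((((Real.sqrt δ.1)⁻¹ : ℝ) : ℂ) • (memLp_dilation δ.2 f).toLp _ : H) x = _
  rw [h1, Pi.smul_apply, h2, smul_eq_mul]

theorem dilationLin_dilationLin (δ ε : Set.Ioi (0 : ℝ)) (h : δ.1 * ε.1 = 1) (f : H) :
    dilationLin δ (dilationLin ε f) = f := by
  have hδ : (0 : ℝ) < δ.1 := δ.2
  apply Lp.ext
  filter_upwards [coeFn_dilationLin δ (dilationLin ε f),
    ae_dilation δ.2 (coeFn_dilationLin ε f)] with x h1 h2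
  rw [h1, h2, ← mul_assoc, ← mul_assoc, ← mul_inv, mul_comm ε.1, h, ← Complex.ofReal_mul,
    ← mul_inv, ← Real.sqrt_mul hδ.le, h]
  simp

theorem norm_dilationLin (δ : Set.Ioi (0 : ℝ)) (f : H) : ‖dilationLin δ f‖ = ‖f‖ := by
  have hδ : (0 : ℝ) < δ.1 := δ.2
  have h0 : δ.1⁻¹ ≠ 0 := (inv_pos.2 hδ).ne'
  have hI (g : H) : ‖g‖ ^ 2 = ∫ x, ‖g x‖ ^ 2 := by
    have := L2.inner_def (𝕜 := ℂ) g g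
    rw [inner_self_eq_norm_sq_to_K] at this
    have h2 : ((‖g‖ ^ 2 : ℝ) : ℂ) = ((∫ x, ‖g x‖ ^ 2 : ℝ) : ℂ) := by
      rw [← integral_complex_ofReal]
      simpa [inner_self_eq_norm_sq_to_K] using this
    exact_mod_cast h2
  refine (sq_eq_sq₀ (norm_nonneg _) (norm_nonneg _)).1 ?_
  rw [hI, hI, integral_congr_ae (g := fun x => δ.1⁻¹ * (fun y => ‖f y‖ ^ 2) (δ.1⁻¹ * x))]
  · rw [integral_const_mul, Measure.integral_comp_mul_left (fun y => ‖f y‖ ^ 2) δ.1⁻¹, inv_inv,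
      abs_of_pos hδ, smul_eq_mul, inv_mul_cancel_left₀ hδ.ne']
  · filter_upwards [coeFn_dilationLin δ f] with x hx
    rw [hx, norm_mul, mul_pow, Complex.norm_real, Real.norm_eq_abs, sq_abs, inv_pow,
      Real.sq_sqrt hδ.le]

/-- The unitary dilation `D(δ)`, `δ > 0`: `(D(δ) f)(x) = δ^{-1/2} f(x / δ)`, so that
`D(δ) P D(δ)⁻¹ = δ P` and `D(δ) Q D(δ)⁻¹ = δ⁻¹ Q`. -/
def dilation (δ : Set.Ioi (0 : ℝ)) : H ≃ₗᵢ[ℂ] H where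
  toLinearEquiv := LinearEquiv.ofLinearMap (dilationLin δ)
    (dilationLin ⟨δ.1⁻¹, inv_pos.2 (show (0 : ℝ) < δ.1 from δ.2)⟩)
    (LinearMap.ext fun f => dilationLin_dilationLin _ _
      (mul_inv_cancel₀ (show (0 : ℝ) < δ.1 from δ.2).ne') f)
    (LinearMap.ext fun f => dilationLin_dilationLin _ _
      (inv_mul_cancel₀ (show (0 : ℝ) < δ.1 from δ.2).ne') f)
  norm_map' := norm_dilationLin δ

/-- `lim_{δ → ∞} D(δ) A D(δ)⁻¹ = B` in the strong operator topology. -/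
def HasDilationLimit (A B : H →L[ℂ] H) : Prop :=
  ∀ φ : H, Tendsto (fun δ : Set.Ioi (0 : ℝ) => dilation δ (A ((dilation δ).symm φ))) atTop
    (𝓝 (B φ))

end

end ResolventAlgebra

open ResolventAlgebra

/-! Dilations separate the two algebras. Conjugation by $D(\delta)$ turns $aP+bQ$ into $\delta
aP+\delta^{-1}bQ$, so as $\delta\to\infty$ momentum blows up and position dies out: the resolvent
tends to $0$ if $a\ne0$ and to $(ic)^{-1}$ if $a=0$. Operators with a scalar dilation limit are
stable under sums, products and norm limits, because conjugation is bounded uniformly in $\delta$;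
hence every element of the resolvent algebra has one (`exists_scalar_dilationLimit`).

The relativistic evolution spoils this. In momentum space $Q$ is a multiple of the derivative, so
$e^{itH_m}$ shifts $Q$ by $t$ times the velocity $P(P^2+m^2)^{-1/2}$ (`boosted_schwartzEvolution`).
Under dilation the velocity tends to $P/|P|$, an involution that is not a scalar, and the evolved
resolvent of $Q$ tends to $(ic+tP/|P|)^{-1}$ (`hasDilationLimit_evolvedResolvent`). By uniqueness of
strong limits it lies outside the algebra when $t\ne0$.

The unbounded operators are handled on the Schwartz space, where $ic+aP+bQ$ is onto
(`exists_shift_schwartzComb_eq`). Graph closures are needed only in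
`isBoundedInverse_shiftedClosure`; afterwards each resolvent enters through its values on the dense
range of the shifted operator. -/

namespace ResolventAlgebra

/-! ### Functions of temperate growth -/

theorem hasTemperateGrowth_cexp_mul_I :
    Function.HasTemperateGrowth (fun x : ℝ => Complex.exp ((x : ℂ) * Complex.I)) := by
  have hd : ∀ n : ℕ, iteratedDeriv n (fun x : ℝ => Complex.exp ((x : ℂ) * Complex.I)) =
      fun x : ℝ => Complex.I ^ n * Complex.exp ((x : ℂ) * Complex.I) := by
    intro n
    induction n with
    | zero => simp
    | succ n ih =>
      rw [iteratedDeriv_succ, ih]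
      funext x
      have h1 : HasDerivAt (fun x : ℝ => (x : ℂ) * Complex.I) (1 * Complex.I) x :=
        Complex.ofRealCLM.hasDerivAt.mul_const Complex.I
      rw [(h1.cexp.const_mul (Complex.I ^ n)).deriv]
      ring
  -- All derivatives have modulus one, so degree `0` and constant `1` serve for every order.
  refine ⟨?_, fun n => ⟨0, 1, fun x => ?_⟩⟩
  · exact (Complex.ofRealCLM.contDiff.mul contDiff_const).cexp
  · rw [norm_iteratedFDeriv_eq_norm_iteratedDeriv, hd]
    simp [Complex.norm_exp_ofReal_mul_I]

theorem hasTemperateGrowth_phase {θ : ℝ → ℝ} (hθ : θ.HasTemperateGrowth) :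
    Function.HasTemperateGrowth (fun x : ℝ => Complex.exp ((θ x : ℂ) * Complex.I)) :=
  hasTemperateGrowth_cexp_mul_I.comp hθ

theorem hasTemperateGrowth_const_mul (k : ℝ) :
    Function.HasTemperateGrowth (fun x : ℝ => k * x) :=
  (Function.HasTemperateGrowth.const k).mul Function.HasTemperateGrowth.id'

/-- For $m>0$ the root is $m\,(1+(p/m)^2)^{1/2}$, a rescaled Japanese bracket. This smoothness is
what lets $e^{itH_m}$ preserve the Schwartz space. -/
theorem hasTemperateGrowth_sqrt {m : ℝ} (hm : 0 < m) :
    Function.HasTemperateGrowth (fun p : ℝ => Real.sqrt (p ^ 2 + m ^ 2)) := by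
  have h := (Function.HasTemperateGrowth.const m).mul
    ((Function.hasTemperateGrowth_one_add_norm_sq_rpow ℝ (1 / 2)).comp
      (hasTemperateGrowth_const_mul m⁻¹))
  refine cast (congrArg Function.HasTemperateGrowth (funext fun p => ?_)) h
  simp only [Pi.mul_apply, Function.comp_apply, Real.norm_eq_abs, sq_abs]
  have h1 : p ^ 2 + m ^ 2 = m ^ 2 * (1 + (m⁻¹ * p) ^ 2) := by
    field_simp
    ring
  rw [← Real.sqrt_eq_rpow, h1, Real.sqrt_mul (sq_nonneg _), Real.sqrt_sq hm.le]

/-- Rationalising the denominator gives $(-ic+kx)\,c^{-2}(1+(kx/c)^2)^{-1}$, a product of functions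
of temperate growth. -/
theorem hasTemperateGrowth_inv_shift {c : ℝ} (hc : c ≠ 0) (k : ℝ) :
    Function.HasTemperateGrowth
      (fun x : ℝ => (Complex.I * (c : ℂ) + (k : ℂ) * (x : ℂ))⁻¹) := by
  have h1 : Function.HasTemperateGrowth
      (fun x : ℝ => ((c ^ 2)⁻¹ : ℝ) * (1 + ‖(k / c) * x‖ ^ 2) ^ (-1 : ℝ)) :=
    (Function.HasTemperateGrowth.const (c ^ 2)⁻¹).mul
      ((Function.hasTemperateGrowth_one_add_norm_sq_rpow ℝ (-1)).comp
        (hasTemperateGrowth_const_mul (k / c)))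
  have h2 : Function.HasTemperateGrowth
      (fun x : ℝ => (-(Complex.I * (c : ℂ))) + ((k * x : ℝ) : ℂ)) :=
    (Function.HasTemperateGrowth.const _).add
      (Function.HasTemperateGrowth.comp Function.Complex.hasTemperateGrowth_ofReal
        (hasTemperateGrowth_const_mul k))
  have h := h2.mul (Function.HasTemperateGrowth.comp Function.Complex.hasTemperateGrowth_ofReal h1)
  refine cast (congrArg Function.HasTemperateGrowth (funext fun x => ?_)) h
  simp only [Pi.mul_apply, Function.comp_apply, Real.norm_eq_abs, sq_abs, Real.rpow_neg_one]
  have h0 : (Complex.I * (c : ℂ) + (k : ℂ) * (x : ℂ)) ≠ 0 := by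
    intro h0
    have := congrArg Complex.im h0
    simp at this
    exact hc this
  have h4 : (c : ℂ) ≠ 0 := by exact_mod_cast hc
  have h5 : (c ^ 2 + (k * x) ^ 2 : ℝ) ≠ 0 := by positivity
  have h6 : ((c : ℂ) ^ 2 + ((k : ℂ) * x) ^ 2 : ℂ) ≠ 0 := by exact_mod_cast h5
  have h3 : (c ^ 2)⁻¹ * (1 + (k / c * x) ^ 2)⁻¹ = (c ^ 2 + (k * x) ^ 2)⁻¹ := by
    rw [← mul_inv]
    congr 1
    field_simp
  rw [h3]
  have h7 : (-(Complex.I * (c : ℂ)) + (k : ℂ) * x) * (Complex.I * (c : ℂ) + (k : ℂ) * x) =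
      (c : ℂ) ^ 2 + ((k : ℂ) * x) ^ 2 := by
    linear_combination (-(c : ℂ) ^ 2) * Complex.I_sq
  push_cast
  refine eq_inv_of_mul_eq_one_left ?_
  rw [mul_right_comm, h7, mul_inv_cancel₀ h6]

theorem hasTemperateGrowth_ofReal : Function.HasTemperateGrowth (fun x : ℝ => (x : ℂ)) :=
  Function.Complex.hasTemperateGrowth_ofReal

/-! ### The operators on Schwartz functions -/

/-- The embedding of the Schwartz functions in `L²(ℝ)`. -/
noncomputable abbrev ι : 𝓢(ℝ, ℂ) →L[ℂ] H := toLpCLM ℂ ℂ 2 (volume : Measure ℝ)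

theorem denseRange_ι : DenseRange ι :=
  denseRange_toLpCLM (F := ℂ) (E := ℝ) (μ := volume) ENNReal.ofNat_ne_top

/-- Multiplication by `x` on the Schwartz space. -/
noncomputable abbrev schwartzQ : 𝓢(ℝ, ℂ) →L[ℂ] 𝓢(ℝ, ℂ) :=
  smulLeftCLM ℂ (fun x : ℝ => (x : ℂ))

/-- `-i d/dx` on the Schwartz space. -/
noncomputable abbrev schwartzP : 𝓢(ℝ, ℂ) →L[ℂ] 𝓢(ℝ, ℂ) := -Complex.I • derivCLM ℂ ℂ

/-- `a P + b Q` on the Schwartz space. -/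
noncomputable def schwartzComb (a b : ℝ) : 𝓢(ℝ, ℂ) →L[ℂ] 𝓢(ℝ, ℂ) :=
  (a : ℂ) • schwartzP + (b : ℂ) • schwartzQ

theorem schwartzQ_apply (f : 𝓢(ℝ, ℂ)) (x : ℝ) : schwartzQ f x = x * f x := by
  rw [schwartzQ, smulLeftCLM_apply_apply hasTemperateGrowth_ofReal, smul_eq_mul]

theorem schwartzP_apply (f : 𝓢(ℝ, ℂ)) (x : ℝ) : schwartzP f x = -Complex.I * deriv f x := rfl

theorem schwartzComb_apply (a b : ℝ) (f : 𝓢(ℝ, ℂ)) (x : ℝ) :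
    schwartzComb a b f x = a * (-Complex.I * deriv f x) + b * (x * f x) := by
  rw [← schwartzQ_apply]; rfl

theorem inner_ι (f g : 𝓢(ℝ, ℂ)) :
    inner ℂ (ι f) (ι g) = ∫ x, (starRingEnd ℂ) (f x) * g x := by
  refine (inner_toL2_toL2_eq f g volume).trans ?_
  simp [mul_comm]

/-- `A` is symmetric with respect to the `L²` inner product. -/
def IsSchwartzSymmetric (A : 𝓢(ℝ, ℂ) →L[ℂ] 𝓢(ℝ, ℂ)) : Prop :=
  ∀ f g, inner ℂ (ι (A f)) (ι g) = inner ℂ (ι f) (ι (A g))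

theorem isSchwartzSymmetric_schwartzQ : IsSchwartzSymmetric schwartzQ := by
  intro f g
  rw [inner_ι, inner_ι]
  congr 1
  funext x
  rw [schwartzQ_apply, schwartzQ_apply, map_mul, Complex.conj_ofReal]
  ring

theorem isSchwartzSymmetric_schwartzP : IsSchwartzSymmetric schwartzP := by
  intro f g
  have h := integral_bilinear_deriv_right_eq_neg_left f g
    ((ContinuousLinearMap.mul ℝ ℂ) ∘L (Complex.conjCLE : ℂ →L[ℝ] ℂ))
  simp only [ContinuousLinearMap.comp_apply, ContinuousLinearMap.mul_apply'] at h
  rw [inner_ι, inner_ι]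
  simp only [schwartzP_apply, map_mul, map_neg, Complex.conj_I, neg_neg]
  calc _ = Complex.I * ∫ x, (starRingEnd ℂ) (deriv f x) * g x := by
        rw [← integral_const_mul]; congr 1; funext x; ring
    _ = -Complex.I * ∫ x, (starRingEnd ℂ) (f x) * deriv g x := by
        have h' : ∫ x, (starRingEnd ℂ) (f x) * deriv g x =
          -∫ x, (starRingEnd ℂ) (deriv f x) * g x := h
        rw [h']; ring
    _ = _ := by rw [← integral_const_mul]; congr 1; funext x; ring

theorem isSchwartzSymmetric_schwartzComb (a b : ℝ) : IsSchwartzSymmetric (schwartzComb a b) := by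
  intro f g
  have h (f : 𝓢(ℝ, ℂ)) : ι (schwartzComb a b f) =
      (a : ℂ) • ι (schwartzP f) + (b : ℂ) • ι (schwartzQ f) := rfl
  rw [h, h, inner_add_left, inner_add_right, inner_smul_left, inner_smul_right, inner_smul_left,
    inner_smul_right, Complex.conj_ofReal, Complex.conj_ofReal, isSchwartzSymmetric_schwartzQ,
    isSchwartzSymmetric_schwartzP]

theorem I_mul_add_ne_zero {c : ℝ} (hc : c ≠ 0) (x : ℝ) : Complex.I * (c : ℂ) + (x : ℂ) ≠ 0 := by
  intro h0
  have := congrArg Complex.im h0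
  simp at this
  exact hc this

theorem exists_shift_mul_eq {c : ℝ} (hc : c ≠ 0) (k : ℝ) (h : 𝓢(ℝ, ℂ)) :
    ∃ f : 𝓢(ℝ, ℂ), ∀ x : ℝ, (Complex.I * (c : ℂ) + (k : ℂ) * (x : ℂ)) * f x = h x := by
  refine ⟨smulLeftCLM ℂ (fun x : ℝ => (Complex.I * (c : ℂ) + (k : ℂ) * (x : ℂ))⁻¹) h,
    fun x => ?_⟩
  rw [smulLeftCLM_apply_apply (hasTemperateGrowth_inv_shift hc k), smul_eq_mul, ← mul_assoc,
    mul_inv_cancel₀, one_mul]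
  exact_mod_cast I_mul_add_ne_zero hc (k * x)

theorem deriv_fourierInv (u : 𝓢(ℝ, ℂ)) :
    derivCLM ℂ ℂ (𝓕⁻ u) = 𝓕⁻ ((2 * Real.pi * Complex.I) • schwartzQ u) := by
  have h := lineDerivOp_fourierInv_eq u (1 : ℝ)
  have h2 : (smulLeftCLM ℂ (inner ℝ · (1 : ℝ)) u : 𝓢(ℝ, ℂ)) = schwartzQ u := by
    ext x
    rw [smulLeftCLM_apply_apply (Function.hasTemperateGrowth_inner_left 1), schwartzQ_apply]
    simp
  rw [h2] at h
  rw [← h]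
  ext x
  rw [derivCLM_apply, lineDerivOp_apply_eq_fderiv, fderiv_apply_one_eq_deriv]

/-- The Fourier transform reduces the equation to division by $ic+2\pi a\xi$, which does not vanish.
-/
theorem exists_shift_deriv_eq {c : ℝ} (hc : c ≠ 0) (a : ℝ) (k : 𝓢(ℝ, ℂ)) :
    ∃ g : 𝓢(ℝ, ℂ), ∀ x : ℝ,
      Complex.I * (c : ℂ) * g x + a * (-Complex.I * deriv g x) = k x := by
  obtain ⟨u, hu⟩ := exists_shift_mul_eq hc (2 * Real.pi * a) (𝓕 k)
  refine ⟨𝓕⁻ u, fun x => ?_⟩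
  have h : (Complex.I * (c : ℂ)) • 𝓕⁻ u + (-(a : ℂ) * Complex.I) • derivCLM ℂ ℂ (𝓕⁻ u) = k := by
    rw [deriv_fourierInv, ← FourierTransform.fourierInv_smul, ← FourierTransform.fourierInv_smul,
      ← FourierTransform.fourierInv_add]
    rw [show (Complex.I * (c : ℂ)) • u + (-(a : ℂ) * Complex.I) •
      ((2 * Real.pi * Complex.I) • schwartzQ u) = 𝓕 k from ?_]
    · exact FourierTransform.fourierInv_fourier_eq k
    · ext y
      rw [← hu y]
      change Complex.I * (c : ℂ) * u y + (-(a : ℂ) * Complex.I) *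
        ((2 * Real.pi * Complex.I) * schwartzQ u y) = _
      rw [schwartzQ_apply]
      push_cast
      linear_combination (-2 * Real.pi * a * y * u y : ℂ) * Complex.I_sq
  have h' := DFunLike.congr_fun h x
  rw [← h']
  change _ = Complex.I * (c : ℂ) * (𝓕⁻ u : 𝓢(ℝ, ℂ)) x +
    (-(a : ℂ) * Complex.I) * deriv (𝓕⁻ u : 𝓢(ℝ, ℂ)) x
  ring

/-- For $a=0$ this is division by $ic+bx$. For $a\ne0$ a quadratic phase gauges $bQ$ away and leaves
the constant coefficient equation for $ic+aP$. -/
theorem exists_shift_schwartzComb_eq {c : ℝ} (hc : c ≠ 0) (a b : ℝ) (h : 𝓢(ℝ, ℂ)) :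
    ∃ f : 𝓢(ℝ, ℂ), (Complex.I * (c : ℂ)) • f + schwartzComb a b f = h := by
  by_cases ha : a = 0
  · subst ha
    obtain ⟨f, hf⟩ := exists_shift_mul_eq hc b h
    refine ⟨f, SchwartzMap.ext fun x => ?_⟩
    change Complex.I * (c : ℂ) * f x + schwartzComb 0 b f x = h x
    rw [schwartzComb_apply, ← hf x]
    push_cast
    ring
  have haC : (a : ℂ) ≠ 0 := by exact_mod_cast ha
  -- Chosen so that $a\theta'(x)=bx$; then $(aP+bQ)(e^{-i\theta}g)=e^{-i\theta}\,aPg$.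
  set θ : ℝ → ℝ := fun x => b / (2 * a) * x * x with hθ
  have hθg : Function.HasTemperateGrowth θ :=
    (hasTemperateGrowth_const_mul _).mul Function.HasTemperateGrowth.id'
  have hθn : Function.HasTemperateGrowth (fun x => -θ x) := hθg.neg
  obtain ⟨g, hg⟩ := exists_shift_deriv_eq hc a
    (smulLeftCLM ℂ (fun x : ℝ => Complex.exp ((θ x : ℂ) * Complex.I)) h)
  refine ⟨smulLeftCLM ℂ (fun x : ℝ => Complex.exp (((-θ x : ℝ) : ℂ) * Complex.I)) g,
    SchwartzMap.ext fun x => ?_⟩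
  set f := smulLeftCLM ℂ (fun x : ℝ => Complex.exp (((-θ x : ℝ) : ℂ) * Complex.I)) g with hf
  have hfx : ⇑f = fun x => Complex.exp (((-θ x : ℝ) : ℂ) * Complex.I) * g x := by
    funext x
    rw [hf, smulLeftCLM_apply_apply (hasTemperateGrowth_phase hθn), smul_eq_mul]
  change Complex.I * (c : ℂ) * f x + schwartzComb a b f x = h x
  rw [schwartzComb_apply]
  have hθ' : HasDerivAt (fun x => -θ x) (-(b / a * x)) x := by
    have := (((hasDerivAt_id x).const_mul (b / (2 * a))).mul (hasDerivAt_id x)).neg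
    convert! this using 1
    simp
    field_simp
    ring
  have hd : HasDerivAt f (Complex.exp (((-θ x : ℝ) : ℂ) * Complex.I) *
      (((-(b / a * x) : ℝ) : ℂ) * Complex.I) * g x +
      Complex.exp (((-θ x : ℝ) : ℂ) * Complex.I) * deriv g x) x := by
    rw [hfx]
    exact ((hθ'.ofReal_comp.mul_const Complex.I).cexp).mul (g.hasDerivAt x)
  have hgx := hg x
  rw [smulLeftCLM_apply_apply (hasTemperateGrowth_phase hθg), smul_eq_mul] at hgx
  have he : Complex.exp (((-θ x : ℝ) : ℂ) * Complex.I) * Complex.exp ((θ x : ℂ) * Complex.I) = 1 := by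
    rw [← Complex.exp_add]
    push_cast
    simp
  have hdiv : (a : ℂ) * ((b / a * x : ℝ) : ℂ) = b * x := by
    push_cast
    field_simp
  rw [hd.deriv, congrFun hfx x]
  set e := Complex.exp (((-θ x : ℝ) : ℂ) * Complex.I)
  rw [Complex.ofReal_neg]
  linear_combination e * hgx + h x * he + Complex.I ^ 2 * e * g x * hdiv +
    (b * x * e * g x : ℂ) * Complex.I_sq

/-! ### Bounded inverses of closures of operators defined on Schwartz functions -/

/-- `T` is the operator with domain the Schwartz functions given by `f ↦ G f`. -/
def HasSchwartzGraph (T : H →ₗ.[ℂ] H) (G : 𝓢(ℝ, ℂ) → H) : Prop :=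
  ∀ z : H × H, z ∈ T.graph ↔ ∃ f, z = (ι f, G f)

theorem hasSchwartzGraph_of_apply {T : H →ₗ.[ℂ] H} {G : 𝓢(ℝ, ℂ) → H}
    (hd : T.domain = schwartzDomain) (h : ∀ f (hf : ι f ∈ T.domain), T ⟨ι f, hf⟩ = G f) :
    HasSchwartzGraph T G := by
  rintro ⟨x, y⟩
  rw [LinearPMap.mem_graph_iff]
  constructor
  · rintro ⟨⟨u, hu⟩, rfl, rfl⟩
    obtain ⟨f, hf⟩ : u ∈ schwartzDomain := hd ▸ hu
    change ι f = u at hf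
    subst hf
    exact ⟨f, by rw [h f hu]⟩
  · rintro ⟨f, hf⟩
    obtain ⟨rfl, rfl⟩ := Prod.mk.inj hf
    have hm : ι f ∈ T.domain := by rw [hd]; exact ⟨f, rfl⟩
    exact ⟨⟨ι f, hm⟩, rfl, h f hm⟩

theorem onSchwartz_apply (A : 𝓢(ℝ, ℂ) →L[ℂ] 𝓢(ℝ, ℂ)) (f : 𝓢(ℝ, ℂ))
    (hf : ι f ∈ (onSchwartz A).domain) : onSchwartz A ⟨ι f, hf⟩ = ι (A f) := by
  change ι (A (schwartzEquiv.symm ⟨ι f, hf⟩)) = ι (A f)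
  congr 2
  rw [LinearEquiv.symm_apply_eq]
  rfl

theorem hasSchwartzGraph_linComb (a b : ℝ) :
    HasSchwartzGraph (linComb a b) (fun f => ι (schwartzComb a b f)) := by
  -- The domain of a sum is the intersection of the two domains, both equal to `schwartzDomain`
  -- here.
  refine hasSchwartzGraph_of_apply (inf_idem _) fun f hf => ?_
  have hP : opP ⟨ι f, hf.1⟩ = ι (schwartzP f) := onSchwartz_apply _ _ _
  have hQ : opQ ⟨ι f, hf.2⟩ = ι (schwartzQ f) := onSchwartz_apply _ _ _
  exact congrArg₂ (fun x y : H => (a : ℂ) • x + (b : ℂ) • y) hP hQ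

theorem hasSchwartzGraph_boostedQ (m t : ℝ) :
    HasSchwartzGraph (boostedQ m t) (fun f => (t : ℂ) • velocity m (ι f) + ι (schwartzQ f)) := by
  refine hasSchwartzGraph_of_apply rfl fun f hf => ?_
  have hQ : opQ ⟨ι f, hf⟩ = ι (schwartzQ f) := onSchwartz_apply _ _ _
  exact congrArg (fun x : H => (t : ℂ) • velocity m (ι f) + x) hQ

/-- The relation $R(icx+y)=x$ is closed, so it passes from the graph to its closure: this is the
left inverse. Density of the range puts every $(R\varphi,\varphi-icR\varphi)$ in that closure: this
is the right inverse. -/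
theorem isBoundedInverse_shiftedClosure {T : H →ₗ.[ℂ] H} {G : 𝓢(ℝ, ℂ) → H}
    (hT : HasSchwartzGraph T G) {c : ℝ} {R : H →L[ℂ] H} (hinj : ∀ η, R η = 0 → η = 0)
    (hR : ∀ f, R ((Complex.I * (c : ℂ)) • ι f + G f) = ι f)
    (hd : DenseRange fun f => (Complex.I * (c : ℂ)) • ι f + G f) :
    IsBoundedInverse (shiftedClosure c T) R := by
  have h1 : ∀ z ∈ T.graph.topologicalClosure, R ((Complex.I * (c : ℂ)) • z.1 + z.2) = z.1 := by
    have hc : IsClosed {z : H × H | R ((Complex.I * (c : ℂ)) • z.1 + z.2) = z.1} :=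
      isClosed_eq (by fun_prop) (by fun_prop)
    refine fun z hz => closure_minimal (fun w hw => ?_) hc hz
    obtain ⟨f, rfl⟩ := (hT w).1 hw
    exact hR f
  have h2 : ∀ φ : H, (R φ, φ - (Complex.I * (c : ℂ)) • R φ) ∈ T.graph.topologicalClosure := by
    intro φ
    refine hd.induction_on (p := fun φ : H =>
      (R φ, φ - (Complex.I * (c : ℂ)) • R φ) ∈ T.graph.topologicalClosure) φ ?_ fun f => ?_
    · exact T.graph.isClosed_topologicalClosure.preimage
        (f := fun φ : H => (R φ, φ - (Complex.I * (c : ℂ)) • R φ)) (by fun_prop)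
    · rw [hR, add_sub_cancel_left]
      exact T.graph.le_topologicalClosure ((hT _).2 ⟨f, rfl⟩)
  -- `LinearPMap.closure` returns `T` itself when `T` is not closable, so closability has to be
  -- proved. A limit point $(0,y)$ of the graph satisfies $Ry=0$, hence $y=0$ by injectivity.
  have hcl : T.IsClosable := by
    refine ⟨T.graph.topologicalClosure.toLinearPMap,
      (Submodule.toLinearPMap_graph_eq _ fun z hz hz0 => ?_).symm⟩
    have := h1 z hz
    rw [hz0, smul_zero, zero_add] at this
    exact hinj _ this
  rw [hcl.graph_closure_eq_closure_graph] at h1 h2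
  constructor
  · rintro ⟨u, hu⟩
    exact h1 (u, T.closure ⟨u, hu⟩) (T.closure.mem_graph ⟨u, hu⟩)
  · intro φ
    obtain ⟨⟨u, hu⟩, hu1, hu2⟩ := (LinearPMap.mem_graph_iff _).1 (h2 φ)
    change u = R φ at hu1
    subst hu1
    refine ⟨hu, ?_⟩
    change (Complex.I * (c : ℂ)) • R φ + T.closure ⟨R φ, hu⟩ = φ
    rw [hu2]
    exact add_sub_cancel _ _

theorem IsBoundedInverse.unique {S : H →ₗ.[ℂ] H} {R R' : H →L[ℂ] H} (h : IsBoundedInverse S R)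
    (h' : IsBoundedInverse S R') : R = R' := by
  ext1 φ
  obtain ⟨hφ, hS⟩ := h.2 φ
  have := h'.1 ⟨R φ, hφ⟩
  rw [hS] at this
  exact this.symm

theorem IsBoundedInverse.boundedInverse {S : H →ₗ.[ℂ] H} {R : H →L[ℂ] H}
    (h : IsBoundedInverse S R) : IsBoundedInverse S (boundedInverse S) := by
  have hex : ∃ R, IsBoundedInverse S R := ⟨R, h⟩
  rw [ResolventAlgebra.boundedInverse, dif_pos hex]
  exact hex.choose_spec

theorem IsBoundedInverse.injective {S : H →ₗ.[ℂ] H} {R : H →L[ℂ] H}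
    (h : IsBoundedInverse S R) {η : H} (hη : R η = 0) : η = 0 := by
  obtain ⟨hφ, hS⟩ := h.2 η
  rw [← hS]
  have : (⟨R η, hφ⟩ : S.domain) = 0 := Subtype.ext hη
  rw [this, LinearPMap.map_zero]

theorem IsBoundedInverse.apply_schwartz {T : H →ₗ.[ℂ] H} {G : 𝓢(ℝ, ℂ) → H}
    (hT : HasSchwartzGraph T G) {c : ℝ} {R : H →L[ℂ] H}
    (h : IsBoundedInverse (shiftedClosure c T) R) (f : 𝓢(ℝ, ℂ)) :
    R ((Complex.I * (c : ℂ)) • ι f + G f) = ι f := by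
  have hg : (ι f, G f) ∈ T.closure.graph :=
    LinearPMap.le_graph_of_le T.le_closure ((hT _).2 ⟨f, rfl⟩)
  obtain ⟨⟨u, hu⟩, hu1, hu2⟩ := (LinearPMap.mem_graph_iff _).1 hg
  change u = ι f at hu1
  subst hu1
  change _ = G f at hu2
  rw [← hu2]
  exact h.1 ⟨ι f, hu⟩

/-! ### Resolvents of symmetric operators on Schwartz functions -/

/-- By symmetry $\langle Af,f\rangle$ is real, so $\mathrm{Im}\,\langle(ic+A)f,f\rangle=-c\|f\|^2$,
and Cauchy–Schwarz applies. -/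
theorem IsSchwartzSymmetric.norm_le {A : 𝓢(ℝ, ℂ) →L[ℂ] 𝓢(ℝ, ℂ)} (hA : IsSchwartzSymmetric A)
    {c : ℝ} (hc : c ≠ 0) (f : 𝓢(ℝ, ℂ)) :
    ‖ι f‖ ≤ |c|⁻¹ * ‖ι ((Complex.I * (c : ℂ)) • f + A f)‖ := by
  have h1 : (inner ℂ (ι (A f)) (ι f)).im = 0 := by
    rw [← Complex.conj_eq_iff_im, inner_conj_symm, hA]
  have h2 : (inner ℂ (ι ((Complex.I * (c : ℂ)) • f + A f)) (ι f)).im = -c * ‖ι f‖ ^ 2 := by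
    rw [map_add, map_smul, inner_add_left, inner_smul_left, inner_self_eq_norm_sq_to_K,
      Complex.add_im, h1]
    simp [← Complex.ofReal_pow]
  have h3 := (Complex.abs_im_le_norm _).trans
    (norm_inner_le_norm (𝕜 := ℂ) (ι ((Complex.I * (c : ℂ)) • f + A f)) (ι f))
  rw [h2, abs_mul, abs_neg, abs_of_nonneg (sq_nonneg ‖ι f‖)] at h3
  have hc' : 0 < |c| := abs_pos.2 hc
  rw [inv_mul_eq_div, le_div_iff₀ hc']
  rcases (norm_nonneg (ι f)).eq_or_lt with h0 | h0
  · rw [← h0, zero_mul]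
    exact norm_nonneg _
  · refine le_of_mul_le_mul_right ?_ h0
    calc _ = |c| * ‖ι f‖ ^ 2 := by ring
      _ ≤ _ := h3

theorem denseRange_of_surjective {A : 𝓢(ℝ, ℂ) → 𝓢(ℝ, ℂ)} (hA : Function.Surjective A) :
    DenseRange fun f => ι (A f) :=
  denseRange_ι.comp hA.denseRange ι.continuous

theorem IsSchwartzSymmetric.exists_resolvent {A : 𝓢(ℝ, ℂ) →L[ℂ] 𝓢(ℝ, ℂ)}
    (hA : IsSchwartzSymmetric A) {c : ℝ} (hc : c ≠ 0)
    (hs : Function.Surjective fun f => (Complex.I * (c : ℂ)) • f + A f) :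
    ∃ R : H →L[ℂ] H, ∀ f, R (ι ((Complex.I * (c : ℂ)) • f + A f)) = ι f := by
  let e : 𝓢(ℝ, ℂ) →ₗ[ℂ] H :=
    (ι ∘L ((Complex.I * (c : ℂ)) • ContinuousLinearMap.id ℂ 𝓢(ℝ, ℂ) + A)).toLinearMap
  exact ⟨ι.toLinearMap.extendOfNorm e, fun f =>
    LinearMap.extendOfNorm_eq (f := ι.toLinearMap) (e := e) (denseRange_of_surjective hs)
      ⟨|c|⁻¹, fun f => hA.norm_le hc f⟩ f⟩

/-- On the dense ranges of $ic+A$ and $-ic+A$ this is the symmetry of $A$. It yields both the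
injectivity of resolvents and $R(a,b,c)^*=R(a,b,-c)$. -/
theorem inner_resolvent {A : 𝓢(ℝ, ℂ) →L[ℂ] 𝓢(ℝ, ℂ)} (hA : IsSchwartzSymmetric A)
    {c : ℝ} (hs : ∀ c' : ℝ, c' ≠ 0 →
      Function.Surjective fun f => (Complex.I * (c' : ℂ)) • f + A f) (hc : c ≠ 0)
    {R R' : H →L[ℂ] H}
    (hR : ∀ f, R (ι ((Complex.I * (c : ℂ)) • f + A f)) = ι f)
    (hR' : ∀ f, R' (ι ((Complex.I * ((-c : ℝ) : ℂ)) • f + A f)) = ι f) (φ χ : H) :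
    inner ℂ (R φ) χ = inner ℂ φ (R' χ) := by
  refine (denseRange_of_surjective (hs c hc)).induction_on
    (p := fun φ : H => inner ℂ (R φ) χ = inner ℂ φ (R' χ)) φ
    (isClosed_eq (by fun_prop) (by fun_prop)) fun f => ?_
  refine (denseRange_of_surjective (hs (-c) (neg_ne_zero.2 hc))).induction_on
    (p := fun χ : H => inner ℂ (R _) χ = inner ℂ _ (R' χ)) χ
    (isClosed_eq (by fun_prop) (by fun_prop)) fun g => ?_
  rw [hR, hR', map_add, map_add, map_smul, map_smul, inner_add_left, inner_add_right,
    inner_smul_left, inner_smul_right, hA]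
  simp

theorem isBoundedInverse_basicResolvent (a b : ℝ) {c : ℝ} (hc : c ≠ 0) :
    IsBoundedInverse (shiftedClosure c (linComb a b)) (basicResolvent a b c) := by
  have hs (c' : ℝ) (hc' : c' ≠ 0) :
      Function.Surjective fun f => (Complex.I * (c' : ℂ)) • f + schwartzComb a b f :=
    exists_shift_schwartzComb_eq hc' a b
  have hA := isSchwartzSymmetric_schwartzComb a b
  obtain ⟨R, hR⟩ := hA.exists_resolvent hc (hs c hc)
  obtain ⟨R', hR'⟩ := hA.exists_resolvent (neg_ne_zero.2 hc) (hs (-c) (neg_ne_zero.2 hc))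
  refine (isBoundedInverse_shiftedClosure (R := R) (hasSchwartzGraph_linComb a b)
    (fun η hη => ?_) (fun f => ?_) ?_).boundedInverse
  -- The kernel of `R` is orthogonal to the range of `R'`, which contains all Schwartz functions.
  · refine denseRange_ι.eq_zero_of_inner_left (𝕜 := ℂ) fun g => ?_
    rw [← hR' g, ← inner_resolvent hA hs hc hR hR', hη, inner_zero_left]
  · rw [← map_smul, ← map_add, hR]
  · simpa only [map_add, map_smul] using denseRange_of_surjective (hs c hc)

theorem basicResolvent_apply (a b : ℝ) {c : ℝ} (hc : c ≠ 0) (f : 𝓢(ℝ, ℂ)) :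
    basicResolvent a b c (ι ((Complex.I * (c : ℂ)) • f + schwartzComb a b f)) = ι f := by
  rw [map_add, map_smul]
  exact (isBoundedInverse_basicResolvent a b hc).apply_schwartz (hasSchwartzGraph_linComb a b) f

theorem star_basicResolvent (a b : ℝ) {c : ℝ} (hc : c ≠ 0) :
    star (basicResolvent a b c) = basicResolvent a b (-c) := by
  rw [ContinuousLinearMap.star_eq_adjoint]
  refine ((ContinuousLinearMap.eq_adjoint_iff _ _).2 fun x y => ?_).symm
  exact inner_resolvent (isSchwartzSymmetric_schwartzComb a b)
    (fun c' hc' => exists_shift_schwartzComb_eq hc' a b) (neg_ne_zero.2 hc)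
    (basicResolvent_apply a b (neg_ne_zero.2 hc))
    (by rw [neg_neg]; exact basicResolvent_apply a b hc) x y

/-! ### Conjugation by dilations -/

/-- `D(δ) A D(δ)⁻¹`. -/
noncomputable def dilConj (δ : Set.Ioi (0 : ℝ)) (A : H →L[ℂ] H) : H →L[ℂ] H :=
  (dilation δ).toContinuousLinearEquiv.toContinuousLinearMap ∘L A ∘L
    (dilation δ).symm.toContinuousLinearEquiv.toContinuousLinearMap

theorem dilConj_apply (δ : Set.Ioi (0 : ℝ)) (A : H →L[ℂ] H) (φ : H) :
    dilConj δ A φ = dilation δ (A ((dilation δ).symm φ)) := rfl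

theorem norm_dilConj_apply_le (δ : Set.Ioi (0 : ℝ)) (A : H →L[ℂ] H) (φ : H) :
    ‖dilConj δ A φ‖ ≤ ‖A‖ * ‖φ‖ := by
  rw [dilConj_apply, LinearIsometryEquiv.norm_map]
  refine (A.le_opNorm _).trans_eq ?_
  rw [LinearIsometryEquiv.norm_map]

theorem tendsto_dilConj_zero (A : H →L[ℂ] H) {y : Set.Ioi (0 : ℝ) → H}
    (hy : Tendsto y atTop (𝓝 0)) : Tendsto (fun δ => dilConj δ A (y δ)) atTop (𝓝 0) := by
  refine squeeze_zero_norm (fun δ => norm_dilConj_apply_le δ A (y δ)) ?_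
  simpa using hy.norm.const_mul ‖A‖

theorem tendsto_inv_Ioi : Tendsto (fun δ : Set.Ioi (0 : ℝ) => (δ.1)⁻¹) atTop (𝓝 0) :=
  tendsto_comp_val_Ioi_atTop.2 tendsto_inv_atTop_zero

theorem tendsto_inv_Ioi_complex :
    Tendsto (fun δ : Set.Ioi (0 : ℝ) => (((δ.1)⁻¹ : ℝ) : ℂ)) atTop (𝓝 0) := by
  have := (Complex.continuous_ofReal.tendsto 0).comp tendsto_inv_Ioi
  rw [Complex.ofReal_zero] at this
  exact this

/-- The conjugates are bounded by $\|A\|$ uniformly in $\delta$, so convergence on a dense set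
suffices. Each limit below uses a dense set adapted to it. -/
theorem hasDilationLimit_of_denseRange {A B : H →L[ℂ] H} {β : Type*} {e : β → H}
    (he : DenseRange e)
    (h : ∀ b, Tendsto (fun δ => dilConj δ A (e b)) atTop (𝓝 (B (e b)))) :
    HasDilationLimit A B := by
  intro φ
  change Tendsto (fun δ => dilConj δ A φ) atTop (𝓝 (B φ))
  rw [Metric.tendsto_nhds]
  intro ε hε
  have hpos : 0 < ‖A‖ + ‖B‖ + 1 := by positivity
  obtain ⟨b, hb⟩ := he.exists_dist_lt φ (show 0 < ε / 2 / (‖A‖ + ‖B‖ + 1) by positivity)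
  rw [lt_div_iff₀ hpos, dist_eq_norm] at hb
  filter_upwards [Metric.tendsto_nhds.1 (h b) (ε / 2) (by positivity)] with δ hδ
  rw [dist_eq_norm] at hδ ⊢
  calc ‖dilConj δ A φ - B φ‖
      = ‖dilConj δ A (φ - e b) - B (φ - e b) + (dilConj δ A (e b) - B (e b))‖ := by
        rw [map_sub, map_sub]; congr 1; abel
    _ ≤ ‖dilConj δ A (φ - e b)‖ + ‖B (φ - e b)‖ + ‖dilConj δ A (e b) - B (e b)‖ :=
        (norm_add_le _ _).trans (add_le_add_left (norm_sub_le _ _) _)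
    _ ≤ ‖A‖ * ‖φ - e b‖ + ‖B‖ * ‖φ - e b‖ + ‖dilConj δ A (e b) - B (e b)‖ := by
        gcongr
        · exact norm_dilConj_apply_le _ _ _
        · exact B.le_opNorm _
    _ < ε := by nlinarith [norm_nonneg (φ - e b)]

theorem HasDilationLimit.unique {A B B' : H →L[ℂ] H} (h : HasDilationLimit A B)
    (h' : HasDilationLimit A B') : B = B' := by
  have : Nonempty (Set.Ioi (0 : ℝ)) := ⟨⟨1, Set.mem_Ioi.2 one_pos⟩⟩
  ext1 φ
  exact tendsto_nhds_unique (h φ) (h' φ)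

theorem HasDilationLimit.add {A B A' B' : H →L[ℂ] H} (h : HasDilationLimit A B)
    (h' : HasDilationLimit A' B') : HasDilationLimit (A + A') (B + B') := by
  intro φ
  simpa using (h φ).add (h' φ)

theorem HasDilationLimit.mul {A B A' B' : H →L[ℂ] H} (h : HasDilationLimit A B)
    (h' : HasDilationLimit A' B') : HasDilationLimit (A * A') (B * B') := by
  intro φ
  -- With $A_\delta=D(\delta)AD(\delta)^{-1}$, split $A_\delta
  -- A'_\delta\varphi=A_\delta(A'_\delta\varphi-B'\varphi)+A_\delta B'\varphi$; the uniform bound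
  -- kills the first term.
  have h1 : Tendsto (fun δ => dilConj δ A (dilConj δ A' φ - B' φ)) atTop (𝓝 0) :=
    tendsto_dilConj_zero A (by
      have := (h' φ).sub_const (B' φ)
      rw [sub_self] at this
      exact this)
  have h2 := h1.add (h (B' φ))
  rw [zero_add] at h2
  refine h2.congr fun δ => ?_
  rw [← dilConj_apply, ← map_add, sub_add_cancel, dilConj_apply, dilConj_apply,
    LinearIsometryEquiv.symm_apply_apply]
  rfl

theorem hasDilationLimit_scalar (z : ℂ) :
    HasDilationLimit (z • (1 : H →L[ℂ] H)) (z • (1 : H →L[ℂ] H)) := by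
  intro φ
  simp

instance : Nontrivial H := by
  obtain ⟨f, hf⟩ : ∃ f : 𝓢(ℝ, ℂ), f 0 ≠ 0 := by
    let b : ContDiffBump (0 : ℝ) := ⟨1, 2, one_pos, one_lt_two⟩
    have h1 : HasCompactSupport (fun x : ℝ => (b x : ℂ)) :=
      b.hasCompactSupport.comp_left Complex.ofReal_zero
    refine ⟨h1.toSchwartzMap (Complex.ofRealCLM.contDiff.comp b.contDiff), ?_⟩
    change (b 0 : ℂ) ≠ 0
    rw [b.one_of_mem_closedBall (by simp [b.rIn_pos.le])]
    simp
  refine ⟨ι f, ι 0, fun h => hf ?_⟩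
  have := injective_toLp 2 (volume : Measure ℝ) h
  rw [this]
  rfl

/-- Testing on one nonzero vector gives $|z_i-z_j|\le\|A_i-A_j\|$. So the scalars of a convergent
sequence are Cauchy, and a three-term estimate identifies their limit. -/
theorem isClosed_scalarDilationLimit :
    IsClosed {A : H →L[ℂ] H | ∃ z : ℂ, HasDilationLimit A (z • (1 : H →L[ℂ] H))} := by
  refine isSeqClosed_iff_isClosed.1 fun A L hA hAL => ?_
  choose z hz using hA
  obtain ⟨φ₀, hφ₀⟩ := exists_ne (0 : H)
  have hφ : 0 < ‖φ₀‖ := norm_pos_iff.2 hφ₀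
  have : Nonempty (Set.Ioi (0 : ℝ)) := ⟨⟨1, Set.mem_Ioi.2 one_pos⟩⟩
  have hzz : ∀ i j, dist (z i) (z j) ≤ dist (A i) (A j) := by
    intro i j
    have h1 : Tendsto (fun δ => dilConj δ (A i - A j) φ₀) atTop (𝓝 ((z i - z j) • φ₀)) := by
      have := ((hz i) φ₀).sub ((hz j) φ₀)
      convert this using 1
      · funext δ
        simp [dilConj_apply]
      · simp [sub_smul]
    have h2 := le_of_tendsto h1.norm
      (Eventually.of_forall fun δ => norm_dilConj_apply_le δ (A i - A j) φ₀)
    rw [norm_smul] at h2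
    rw [dist_eq_norm, dist_eq_norm]
    exact le_of_mul_le_mul_right h2 hφ
  have hc : CauchySeq z := by
    have := hAL.cauchySeq
    rw [Metric.cauchySeq_iff] at this ⊢
    intro ε hε
    obtain ⟨N, hN⟩ := this ε hε
    exact ⟨N, fun m hm n hn => (hzz m n).trans_lt (hN m hm n hn)⟩
  obtain ⟨w, hw⟩ := cauchySeq_tendsto_of_complete hc
  refine ⟨w, fun φ => ?_⟩
  change Tendsto (fun δ => dilConj δ L φ) atTop (𝓝 ((w • (1 : H →L[ℂ] H)) φ))
  rw [Metric.tendsto_nhds]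
  intro ε hε
  have hpos : 0 < ‖φ‖ + ‖φ‖ + 1 := by positivity
  set η := ε / 2 / (‖φ‖ + ‖φ‖ + 1) with hη
  have hηp : 0 < η := by positivity
  obtain ⟨n, hn1, hn2⟩ := ((Metric.tendsto_nhds.1 hAL η hηp).and
    (Metric.tendsto_nhds.1 hw η hηp)).exists
  filter_upwards [Metric.tendsto_nhds.1 (hz n φ) (ε / 2) (by positivity)] with δ hδ
  rw [dist_eq_norm] at hδ hn1 hn2 ⊢
  calc ‖dilConj δ L φ - (w • (1 : H →L[ℂ] H)) φ‖
      = ‖(dilConj δ (A n) φ - (z n • (1 : H →L[ℂ] H)) φ) - dilConj δ (A n - L) φ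
          + (z n - w) • φ‖ := by
        simp only [dilConj_apply, sub_apply, map_sub, sub_smul, smul_apply,
          one_apply_eq_self]
        congr 1; abel
    _ ≤ ‖dilConj δ (A n) φ - (z n • (1 : H →L[ℂ] H)) φ‖ + ‖A n - L‖ * ‖φ‖ + ‖z n - w‖ * ‖φ‖ := by
        refine (norm_add_le _ _).trans (add_le_add ((norm_sub_le _ _).trans ?_) (norm_smul_le _ _))
        gcongr
        exact norm_dilConj_apply_le _ _ _
    _ < ε / 2 + η * ‖φ‖ + η * ‖φ‖ := by
        have : ‖dilConj δ (A n) φ - (z n • (1 : H →L[ℂ] H)) φ‖ < ε / 2 := hδ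
        refine add_lt_add_of_lt_of_le (add_lt_add_of_lt_of_le this ?_) ?_ <;> gcongr
    _ ≤ ε := by
        have : η * (‖φ‖ + ‖φ‖ + 1) = ε / 2 := div_mul_cancel₀ _ hpos.ne'
        nlinarith

/-! ### Dilations of Schwartz functions -/

/-- `f ↦ δ^{-1/2} f(x / δ)` on the Schwartz space. -/
noncomputable def dilS (δ : Set.Ioi (0 : ℝ)) : 𝓢(ℝ, ℂ) →L[ℂ] 𝓢(ℝ, ℂ) :=
  (((Real.sqrt δ.1)⁻¹ : ℝ) : ℂ) • compCLMOfContinuousLinearEquiv ℂ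
    (ContinuousLinearEquiv.unitsEquivAut ℝ (Units.mk0 (δ.1)⁻¹ (inv_pos.2 δ.2).ne'))

theorem dilS_apply (δ : Set.Ioi (0 : ℝ)) (f : 𝓢(ℝ, ℂ)) (x : ℝ) :
    dilS δ f x = (((Real.sqrt δ.1)⁻¹ : ℝ) : ℂ) * f (δ.1⁻¹ * x) := by
  rw [mul_comm δ.1⁻¹]
  rfl

theorem dilation_ι (δ : Set.Ioi (0 : ℝ)) (f : 𝓢(ℝ, ℂ)) : dilation δ (ι f) = ι (dilS δ f) := by
  apply Lp.ext
  filter_upwards [coeFn_dilationLin δ (ι f), ae_dilation δ.2 (f.coeFn_toLp 2 volume),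
    (dilS δ f).coeFn_toLp 2 volume] with x h1 h2 h3
  change (dilationLin δ (ι f)) x = (ι (dilS δ f)) x
  rw [h1]
  refine Eq.trans ?_ h3.symm
  rw [dilS_apply]
  exact congrArg _ h2

/-- The inverse dilation parameter. -/
noncomputable def invIoi (δ : Set.Ioi (0 : ℝ)) : Set.Ioi (0 : ℝ) :=
  ⟨δ.1⁻¹, inv_pos.2 (show (0 : ℝ) < δ.1 from δ.2)⟩

theorem dilation_symm (δ : Set.Ioi (0 : ℝ)) (φ : H) :
    (dilation δ).symm φ = dilation (invIoi δ) φ := rfl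

theorem dilation_ι_symm (δ : Set.Ioi (0 : ℝ)) (f : 𝓢(ℝ, ℂ)) :
    (dilation δ).symm (ι f) = ι (dilS (invIoi δ) f) := by
  rw [dilation_symm, dilation_ι]

theorem dilation_dilS_invIoi (δ : Set.Ioi (0 : ℝ)) (f : 𝓢(ℝ, ℂ)) :
    dilation δ (ι (dilS (invIoi δ) f)) = ι f := by
  rw [← dilation_ι_symm, LinearIsometryEquiv.apply_symm_apply]

theorem schwartzComb_dilS (a b : ℝ) (δ : Set.Ioi (0 : ℝ)) (f : 𝓢(ℝ, ℂ)) :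
    schwartzComb a b (dilS δ f) = dilS δ (schwartzComb (δ.1⁻¹ * a) (δ.1 * b) f) := by
  have hδ : δ.1 ≠ 0 := (show (0 : ℝ) < δ.1 from δ.2).ne'
  have hδC : (δ.1 : ℂ) ≠ 0 := by exact_mod_cast hδ
  ext x
  rw [schwartzComb_apply, dilS_apply, dilS_apply, schwartzComb_apply]
  have hd : HasDerivAt (dilS δ f) ((((Real.sqrt δ.1)⁻¹ : ℝ) : ℂ) *
      ((δ.1⁻¹ : ℝ) • deriv f (δ.1⁻¹ * x))) x := by
    have h1 : HasDerivAt (fun x : ℝ => δ.1⁻¹ * x) (δ.1⁻¹) x := by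
      simpa using (hasDerivAt_id x).const_mul δ.1⁻¹
    have h2 := (HasDerivAt.scomp x (f.hasDerivAt (δ.1⁻¹ * x)) h1).const_mul
      (((Real.sqrt δ.1)⁻¹ : ℝ) : ℂ)
    refine h2.congr_of_eventuallyEq (Eventually.of_forall fun y => ?_)
    rw [dilS_apply]
    rfl
  rw [hd.deriv, Complex.real_smul]
  push_cast
  field_simp

/-- The conjugated resolvent inverts $ic+\delta aP+\delta^{-1}bQ$ on Schwartz functions. -/
theorem dilConj_basicResolvent_apply (a b : ℝ) {c : ℝ} (hc : c ≠ 0) (δ : Set.Ioi (0 : ℝ))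
    (f : 𝓢(ℝ, ℂ)) :
    dilConj δ (basicResolvent a b c)
      (ι ((Complex.I * (c : ℂ)) • f + schwartzComb (δ.1 * a) (δ.1⁻¹ * b) f)) = ι f := by
  have h := schwartzComb_dilS a b (invIoi δ) f
  simp only [invIoi, inv_inv] at h
  rw [dilConj_apply, dilation_ι_symm, map_add, map_smul]
  rw [show dilS (invIoi δ) (schwartzComb (δ.1 * a) (δ.1⁻¹ * b) f) =
    schwartzComb a b (dilS (invIoi δ) f) from h.symm, basicResolvent_apply a b hc,
    dilation_dilS_invIoi]

/-! ### Dilation limits of the basic resolvents -/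

theorem ι_schwartzComb (a b : ℝ) (f : 𝓢(ℝ, ℂ)) :
    ι (schwartzComb a b f) = (a : ℂ) • ι (schwartzP f) + (b : ℂ) • ι (schwartzQ f) := rfl

/-- With $R_\delta$ the conjugated resolvent, $ic\,R_\delta f=f-\delta^{-1}R_\delta\,bQf\to f$. -/
theorem hasDilationLimit_basicResolvent_zero (b : ℝ) {c : ℝ} (hc : c ≠ 0) :
    HasDilationLimit (basicResolvent 0 b c) ((Complex.I * (c : ℂ))⁻¹ • (1 : H →L[ℂ] H)) := by
  have hc' : Complex.I * (c : ℂ) ≠ 0 := by simp [hc]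
  refine hasDilationLimit_of_denseRange denseRange_ι fun f => ?_
  have h0 : Tendsto (fun δ : Set.Ioi (0 : ℝ) => ((δ.1⁻¹ : ℝ) : ℂ) • ((b : ℂ) • ι (schwartzQ f)))
      atTop (𝓝 0) := by
    simpa only [zero_smul] using tendsto_inv_Ioi_complex.smul_const ((b : ℂ) • ι (schwartzQ f))
  have h1 := ((tendsto_dilConj_zero (basicResolvent 0 b c) h0).const_sub (ι f)).const_smul
    (Complex.I * (c : ℂ))⁻¹
  rw [sub_zero] at h1
  refine h1.congr fun δ => ?_
  have h2 := dilConj_basicResolvent_apply 0 b hc δ f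
  rw [map_add, map_smul, ι_schwartzComb, map_add, map_smul, mul_zero, Complex.ofReal_zero,
    zero_smul, zero_add, Complex.ofReal_mul, mul_smul _ (b : ℂ)] at h2
  rw [inv_smul_eq_iff₀ hc']
  exact (eq_sub_of_add_eq h2).symm

/-- If $\eta$ is orthogonal to the range, its Fourier transform $\zeta$ satisfies $\xi\zeta(\xi)=0$
almost everywhere by testing against smooth compactly supported functions. Hence $\zeta=0$, as a
point is null. -/
theorem denseRange_schwartzP : DenseRange fun f => ι (schwartzP f) := by
  let K : Submodule ℂ H := LinearMap.range (ι ∘L schwartzP).toLinearMap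
  suffices hK : K.topologicalClosure = ⊤ from
    (Submodule.dense_iff_topologicalClosure_eq_top (s := K)).2 hK
  rw [Submodule.topologicalClosure_eq_top_iff, Submodule.eq_bot_iff]
  intro η hη
  have h1 : ∀ f, inner ℂ (ι (schwartzP f)) η = 0 := fun f => hη _ ⟨f, rfl⟩
  set ζ : H := 𝓕 η with hζ
  have h2 : ∀ u : 𝓢(ℝ, ℂ), inner ℂ (ι (schwartzQ u)) ζ = 0 := by
    intro u
    have h3 := h1 (𝓕⁻ u)
    have h4 : schwartzP (𝓕⁻ u) = (2 * Real.pi : ℂ) • 𝓕⁻ (schwartzQ u) := by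
      change -Complex.I • derivCLM ℂ ℂ (𝓕⁻ u) = _
      rw [deriv_fourierInv, FourierTransform.fourierInv_smul, smul_smul]
      congr 1
      linear_combination (-2 * Real.pi : ℂ) * Complex.I_sq
    rw [h4, map_smul, inner_smul_left, ← Lp.inner_fourier_eq] at h3
    have h5 : 𝓕 (ι (𝓕⁻ (schwartzQ u))) = ι (schwartzQ u) :=
      (SchwartzMap.toLp_fourier_eq _).trans
        (congrArg ι (FourierTransform.fourier_fourierInv_eq (schwartzQ u)))
    rw [h5] at h3
    refine (mul_eq_zero.1 h3).resolve_left ?_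
    simp [Real.pi_ne_zero]
  have hloc : LocallyIntegrable (fun x : ℝ => (x : ℂ) * ζ x) volume := by
    have := ((Lp.memLp ζ).locallyIntegrable one_le_two)
    have h := (this.locallyIntegrableOn Set.univ).continuousOn_mul
      Complex.continuous_ofReal.continuousOn isOpen_univ.isLocallyClosed
    rwa [locallyIntegrableOn_univ] at h
  have h3 := ae_eq_zero_of_integral_contDiff_smul_eq_zero hloc fun g hg hgs => by
    have hs : HasCompactSupport (fun x : ℝ => (g x : ℂ)) := hgs.comp_left Complex.ofReal_zero
    have := h2 (hs.toSchwartzMap (Complex.ofRealCLM.contDiff.comp hg))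
    rw [L2.inner_def] at this
    rw [← this]
    refine integral_congr_ae ?_
    filter_upwards [(schwartzQ (hs.toSchwartzMap
      (Complex.ofRealCLM.contDiff.comp hg))).coeFn_toLp 2 volume] with x hx
    change _ = inner ℂ ((SchwartzMap.toLp _ 2 volume : H) x) _
    rw [hx, schwartzQ_apply]
    change _ = inner ℂ ((x : ℂ) * (g x : ℂ)) (ζ x)
    rw [← Complex.ofReal_mul, RCLike.inner_apply, Complex.conj_ofReal, Complex.real_smul]
    push_cast
    ring
  have h4 : ζ = 0 := by
    apply Lp.ext
    have hne : ∀ᵐ x : ℝ, x ≠ 0 := by simp [ae_iff]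
    filter_upwards [h3, hne, Lp.coeFn_zero ℂ 2 volume] with x hx hx0 hz
    rw [hz]
    exact (mul_eq_zero.1 hx).resolve_left (by exact_mod_cast hx0)
  rw [← norm_eq_zero, ← Lp.norm_fourier_eq, ← hζ, h4, norm_zero]

/-- On the dense set of vectors $Pf$, the conjugated resolvent $R_\delta$ satisfies $R_\delta
Pf=(\delta a)^{-1}\bigl(f-R_\delta(ic+\delta^{-1}bQ)f\bigr)\to0$. -/
theorem hasDilationLimit_basicResolvent_of_ne {a : ℝ} (ha : a ≠ 0) (b : ℝ) {c : ℝ} (hc : c ≠ 0) :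
    HasDilationLimit (basicResolvent a b c) 0 := by
  refine hasDilationLimit_of_denseRange denseRange_schwartzP fun f => ?_
  have haC : (a : ℂ) ≠ 0 := by exact_mod_cast ha
  have h0 : Tendsto (fun δ : Set.Ioi (0 : ℝ) => (((δ.1⁻¹ : ℝ) : ℂ) * (a : ℂ)⁻¹) • ι f)
      atTop (𝓝 0) := by
    simpa using (tendsto_inv_Ioi_complex.mul_const (a : ℂ)⁻¹).smul_const (ι f)
  have h1 : Tendsto (fun δ : Set.Ioi (0 : ℝ) => (((δ.1⁻¹ : ℝ) : ℂ) * (a : ℂ)⁻¹) •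
      ((Complex.I * (c : ℂ)) • ι f + ((δ.1⁻¹ : ℝ) : ℂ) • ((b : ℂ) • ι (schwartzQ f))))
      atTop (𝓝 0) := by
    simpa only [zero_mul, zero_smul] using
      (tendsto_inv_Ioi_complex.mul_const (a : ℂ)⁻¹).smul
        ((tendsto_inv_Ioi_complex.smul_const ((b : ℂ) • ι (schwartzQ f))).const_add
          ((Complex.I * (c : ℂ)) • ι f))
  have h2 := h0.sub (tendsto_dilConj_zero (basicResolvent a b c) h1)
  rw [sub_zero] at h2
  refine h2.congr fun δ => ?_
  have hδ : (δ.1 : ℂ) ≠ 0 := by exact_mod_cast (show (0 : ℝ) < δ.1 from δ.2).ne'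
  have key : ι (schwartzP f) = (((δ.1⁻¹ : ℝ) : ℂ) * (a : ℂ)⁻¹) •
      ι ((Complex.I * (c : ℂ)) • f + schwartzComb (δ.1 * a) (δ.1⁻¹ * b) f) -
      (((δ.1⁻¹ : ℝ) : ℂ) * (a : ℂ)⁻¹) •
      ((Complex.I * (c : ℂ)) • ι f + ((δ.1⁻¹ : ℝ) : ℂ) • ((b : ℂ) • ι (schwartzQ f))) := by
    rw [← smul_sub, map_add, map_smul, ι_schwartzComb, Complex.ofReal_mul, Complex.ofReal_mul,
      mul_smul (((δ.1⁻¹ : ℝ) : ℂ)) (b : ℂ), add_sub_add_left_eq_sub, add_sub_cancel_right,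
      smul_smul, show ((δ.1⁻¹ : ℝ) : ℂ) * (a : ℂ)⁻¹ * (δ.1 * a) = 1 by push_cast; field_simp,
      one_smul]
  rw [key, map_sub, map_smul _ _ (ι ((Complex.I * (c : ℂ)) • f + _)),
    dilConj_basicResolvent_apply a b hc δ f]

theorem exists_scalar_dilationLimit {A : H →L[ℂ] H} (hA : A ∈ resolventAlgebra) :
    ∃ z : ℂ, HasDilationLimit A (z • (1 : H →L[ℂ] H)) := by
  have hgen (a b c : ℝ) (hc : c ≠ 0) :
      ∃ z : ℂ, HasDilationLimit (basicResolvent a b c) (z • (1 : H →L[ℂ] H)) := by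
    by_cases ha : a = 0
    · subst ha
      exact ⟨_, hasDilationLimit_basicResolvent_zero b hc⟩
    · exact ⟨0, by simpa using hasDilationLimit_basicResolvent_of_ne ha b hc⟩
  have hA' : A ∈ closure (StarAlgebra.adjoin ℂ {R : H →L[ℂ] H |
      ∃ a b c : ℝ, c ≠ 0 ∧ R = basicResolvent a b c} : Set (H →L[ℂ] H)) := hA
  refine closure_minimal (fun B hB => ?_) isClosed_scalarDilationLimit hA'
  -- The adjoint is not strongly continuous, so the induction carries `B` and `star B` together.
  have key : (∃ z : ℂ, HasDilationLimit B (z • (1 : H →L[ℂ] H))) ∧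
      ∃ z : ℂ, HasDilationLimit (star B) (z • (1 : H →L[ℂ] H)) := by
    refine StarAlgebra.adjoin_induction (p := fun B _ =>
      (∃ z : ℂ, HasDilationLimit B (z • (1 : H →L[ℂ] H))) ∧
      ∃ z : ℂ, HasDilationLimit (star B) (z • (1 : H →L[ℂ] H))) ?_ ?_ ?_ ?_ ?_ hB
    · rintro _ ⟨a, b, c, hc, rfl⟩
      refine ⟨hgen a b c hc, ?_⟩
      rw [star_basicResolvent a b hc]
      exact hgen a b (-c) (neg_ne_zero.2 hc)
    · intro r
      rw [Algebra.algebraMap_eq_smul_one, star_smul, star_one]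
      exact ⟨⟨_, hasDilationLimit_scalar r⟩, ⟨_, hasDilationLimit_scalar (star r)⟩⟩
    · rintro x y - - ⟨⟨z, hz⟩, ⟨w, hw⟩⟩ ⟨⟨z', hz'⟩, ⟨w', hw'⟩⟩
      rw [star_add]
      exact ⟨⟨z + z', by rw [add_smul]; exact hz.add hz'⟩,
        ⟨w + w', by rw [add_smul]; exact hw.add hw'⟩⟩
    · rintro x y - - ⟨⟨z, hz⟩, ⟨w, hw⟩⟩ ⟨⟨z', hz'⟩, ⟨w', hw'⟩⟩
      rw [star_mul]
      exact ⟨⟨z * z', by simpa [smul_smul, mul_comm] using hz.mul hz'⟩,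
        ⟨w' * w, by simpa [smul_smul, mul_comm] using hw'.mul hw⟩⟩
    · rintro x - ⟨h1, h2⟩
      rw [star_star]
      exact ⟨h2, h1⟩
  exact key.1

/-! ### Bounded functions of the momentum operator -/

theorem coeFn_mulOp (g : ℝ → ℂ) (hg : MemLp g ⊤ (volume : Measure ℝ)) (f : H) :
    mulOp g hg f =ᵐ[volume] fun x => g x * f x := by
  filter_upwards [(ContinuousLinearMap.mul ℂ ℂ).coeFn_holder (r := 2) (hg.toLp g) f,
    hg.coeFn_toLp] with x h1 h2
  rw [← h2]
  exact h1

theorem fourier_funP {g : ℝ → ℂ} (hg : Measurable g) {C : ℝ} (hC : ∀ p, ‖g p‖ ≤ C) (φ : H) :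
    (𝓕 (funP g hg hC φ) : H) =ᵐ[volume] fun ξ => g (2 * Real.pi * ξ) * (𝓕 φ : H) ξ := by
  have : 𝓕 (funP g hg hC φ) = mulOp (fun ξ => g (2 * Real.pi * ξ)) (memLp_scaled hg hC) (𝓕 φ) :=
    (Lp.fourierTransformₗᵢ ℝ ℂ).apply_symm_apply _
  rw [this]
  exact coeFn_mulOp _ _ _

theorem eq_of_fourier_ae_eq {φ ψ : H} (h : (𝓕 φ : H) =ᵐ[volume] (𝓕 ψ : H)) : φ = ψ :=
  (Lp.fourierTransformₗᵢ ℝ ℂ).injective (Lp.ext h)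

theorem fourier_ι (f : 𝓢(ℝ, ℂ)) : 𝓕 (ι f) = ι (𝓕 f) := SchwartzMap.toLp_fourier_eq f

theorem coeFn_ι (f : 𝓢(ℝ, ℂ)) : ι f =ᵐ[volume] f := f.coeFn_toLp 2 volume

theorem funP_funP {g g' k : ℝ → ℂ} (hg : Measurable g) {C : ℝ} (hC : ∀ p, ‖g p‖ ≤ C)
    (hg' : Measurable g') {C' : ℝ} (hC' : ∀ p, ‖g' p‖ ≤ C')
    (hk : Measurable k) {K : ℝ} (hK : ∀ p, ‖k p‖ ≤ K) (h : ∀ p, g p * g' p = k p) (φ : H) :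
    funP g hg hC (funP g' hg' hC' φ) = funP k hk hK φ := by
  apply eq_of_fourier_ae_eq
  filter_upwards [fourier_funP hg hC (funP g' hg' hC' φ), fourier_funP hg' hC' φ,
    fourier_funP hk hK φ] with ξ h1 h2 h3
  rw [h1, h2, h3, ← h]
  ring

/-- The point $p=0$ is exempt, being null, because `p / |p|` takes the default value `0` there. -/
theorem funP_eq_self {g : ℝ → ℂ} (hg : Measurable g) {C : ℝ} (hC : ∀ p, ‖g p‖ ≤ C)
    (h : ∀ p, p ≠ 0 → g p = 1) (φ : H) : funP g hg hC φ = φ := by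
  apply eq_of_fourier_ae_eq
  have hne : ∀ᵐ x : ℝ, x ≠ 0 := by simp [ae_iff]
  filter_upwards [fourier_funP hg hC φ, hne] with ξ h1 h2
  rw [h1, h _ (mul_ne_zero Real.two_pi_pos.ne' h2), one_mul]

theorem norm_sq_eq_integral (g : H) : ‖g‖ ^ 2 = ∫ x, ‖g x‖ ^ 2 := by
  have := L2.inner_def (𝕜 := ℂ) g g
  rw [inner_self_eq_norm_sq_to_K] at this
  have h2 : ((‖g‖ ^ 2 : ℝ) : ℂ) = ((∫ x, ‖g x‖ ^ 2 : ℝ) : ℂ) := by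
    rw [← integral_complex_ofReal]
    simpa [inner_self_eq_norm_sq_to_K] using this
  exact_mod_cast h2

theorem fourier_dilS (δ : Set.Ioi (0 : ℝ)) (f : 𝓢(ℝ, ℂ)) :
    𝓕 (dilS δ f) = dilS (invIoi δ) (𝓕 f) := by
  have hδ : 0 < δ.1 := δ.2
  ext w
  rw [dilS_apply, SchwartzMap.fourier_coe, SchwartzMap.fourier_coe, Real.fourier_real_eq_integral_exp_smul,
    Real.fourier_real_eq_integral_exp_smul]
  have h := Measure.integral_comp_inv_mul_left (fun v : ℝ =>
    Complex.exp (((-2 * Real.pi * v * (δ.1 * w) : ℝ) : ℂ) * Complex.I) • f v) δ.1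
  rw [abs_of_pos hδ] at h
  have hs : Real.sqrt δ.1 * Real.sqrt δ.1 = δ.1 := Real.mul_self_sqrt hδ.le
  have hs0 : Real.sqrt δ.1 ≠ 0 := (Real.sqrt_pos.2 hδ).ne'
  calc _ = (((Real.sqrt δ.1)⁻¹ : ℝ) : ℂ) * ∫ v : ℝ,
        Complex.exp (((-2 * Real.pi * (δ.1⁻¹ * v) * (δ.1 * w) : ℝ) : ℂ) * Complex.I) •
          f (δ.1⁻¹ * v) := by
        rw [← integral_const_mul]
        congr 1
        funext v
        rw [dilS_apply, smul_eq_mul, smul_eq_mul, mul_left_comm]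
        congr 5
        field_simp
    _ = _ := by
        rw [h, Complex.real_smul, ← mul_assoc, ← Complex.ofReal_mul]
        simp only [invIoi, Real.sqrt_inv, inv_inv]
        congr 2
        rw [inv_mul_eq_iff_eq_mul₀ hs0, hs]

theorem fourier_dilation (δ : Set.Ioi (0 : ℝ)) (φ : H) :
    𝓕 (dilation δ φ) = dilation (invIoi δ) (𝓕 φ) := by
  refine denseRange_ι.induction_on (p := fun φ : H =>
    𝓕 (dilation δ φ) = dilation (invIoi δ) (𝓕 φ)) φ (isClosed_eq ?_ ?_) fun f => ?_
  · exact (Lp.fourierTransformₗᵢ ℝ ℂ).continuous.comp (dilation δ).continuous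
  · exact (dilation _).continuous.comp (Lp.fourierTransformₗᵢ ℝ ℂ).continuous
  · rw [dilation_ι, fourier_ι, fourier_ι, dilation_ι, fourier_dilS]

theorem fourier_dilConj_funP {g : ℝ → ℂ} (hg : Measurable g) {C : ℝ} (hC : ∀ p, ‖g p‖ ≤ C)
    (δ : Set.Ioi (0 : ℝ)) (φ : H) :
    (𝓕 (dilConj δ (funP g hg hC) φ) : H) =ᵐ[volume]
      fun ξ => g (δ.1 * (2 * Real.pi * ξ)) * (𝓕 φ : H) ξ := by
  obtain ⟨ψ, rfl⟩ := (dilation δ).surjective φ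
  rw [dilConj_apply, LinearIsometryEquiv.symm_apply_apply, fourier_dilation, fourier_dilation]
  filter_upwards [coeFn_dilationLin (invIoi δ) (𝓕 (funP g hg hC ψ)),
    coeFn_dilationLin (invIoi δ) (𝓕 ψ),
    ae_dilation (invIoi δ).2 (fourier_funP hg hC ψ)] with ξ h1 h2 h3
  change dilationLin (invIoi δ) (𝓕 (funP g hg hC ψ)) ξ = _ * dilationLin (invIoi δ) (𝓕 ψ) ξ
  rw [h1, h2, h3, mul_left_comm]
  congr 2
  simp only [invIoi, inv_inv]
  ring

/-- In momentum space the conjugate is multiplication by $g(\delta p)$. Plancherel and dominated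
convergence, with majorant $(C+K)^2|\hat\varphi|^2$, give the limit. -/
theorem tendsto_dilConj_funP {g s : ℝ → ℂ} (hg : Measurable g) {C : ℝ} (hC : ∀ p, ‖g p‖ ≤ C)
    (hs : Measurable s) {K : ℝ} (hK : ∀ p, ‖s p‖ ≤ K)
    (h : ∀ p, Tendsto (fun δ : Set.Ioi (0 : ℝ) => g (δ.1 * p)) atTop (𝓝 (s p))) (φ : H) :
    Tendsto (fun δ => dilConj δ (funP g hg hC) φ) atTop (𝓝 (funP s hs hK φ)) := by
  have hcg : (atTop : Filter (Set.Ioi (0 : ℝ))).IsCountablyGenerated := by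
    rw [atTop_Ioi_eq]; infer_instance
  rw [tendsto_iff_norm_sub_tendsto_zero]
  have hmeas : AEStronglyMeasurable (𝓕 φ : H) volume := (Lp.memLp (𝓕 φ : H)).1
  have hlim : Tendsto (fun δ : Set.Ioi (0 : ℝ) => ∫ ξ,
      ‖(g (δ.1 * (2 * Real.pi * ξ)) - s (2 * Real.pi * ξ)) * (𝓕 φ : H) ξ‖ ^ 2) atTop
      (𝓝 (∫ _ : ℝ, (0 : ℝ))) := by
    refine tendsto_integral_filter_of_dominated_convergence
      (fun ξ => (C + K) ^ 2 * ‖(𝓕 φ : H) ξ‖ ^ 2) (Eventually.of_forall fun δ => ?_)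
      (Eventually.of_forall fun δ => Eventually.of_forall fun ξ => ?_) ?_
      (Eventually.of_forall fun ξ => ?_)
    · refine (AEStronglyMeasurable.mul ?_ hmeas).norm.pow 2
      exact ((hg.comp (by fun_prop)).sub (hs.comp (by fun_prop))).aestronglyMeasurable
    · rw [Real.norm_of_nonneg (by positivity), norm_mul, mul_pow]
      gcongr
      exact (norm_sub_le _ _).trans (add_le_add (hC _) (hK _))
    · exact ((memLp_two_iff_integrable_sq_norm hmeas).1 (Lp.memLp _)).const_mul _
    · have h1 := (((h (2 * Real.pi * ξ)).sub_const (s (2 * Real.pi * ξ))).mul_const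
        ((𝓕 φ : H) ξ)).norm.pow 2
      simpa only [sub_self, zero_mul, norm_zero, ne_eq, OfNat.ofNat_ne_zero, not_false_eq_true,
        zero_pow] using h1
  rw [integral_zero] at hlim
  have h2 := (Real.continuous_sqrt.tendsto 0).comp hlim
  rw [Real.sqrt_zero] at h2
  refine h2.congr fun δ => ?_
  rw [Function.comp_apply, ← Lp.norm_fourier_eq, ← Real.sqrt_sq (norm_nonneg (𝓕 (_ : H) : H)),
    norm_sq_eq_integral, show 𝓕 (dilConj δ (funP g hg hC) φ - funP s hs hK φ) =
      𝓕 (dilConj δ (funP g hg hC) φ) - 𝓕 (funP s hs hK φ) from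
      (Lp.fourierTransformₗᵢ ℝ ℂ).map_sub _ _]
  congr 1
  refine integral_congr_ae ?_
  filter_upwards [fourier_dilConj_funP hg hC δ φ, fourier_funP hs hK φ,
    Lp.coeFn_sub (𝓕 (dilConj δ (funP g hg hC) φ) : H) (𝓕 (funP s hs hK φ))] with ξ h3 h4 h5
  rw [h5, Pi.sub_apply, h3, h4, sub_mul]

theorem tendsto_velocity {m : ℝ} (p : ℝ) :
    Tendsto (fun δ : Set.Ioi (0 : ℝ) =>
      ((δ.1 * p / Real.sqrt ((δ.1 * p) ^ 2 + m ^ 2) : ℝ) : ℂ)) atTop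
      (𝓝 ((p / |p| : ℝ) : ℂ)) := by
  refine (Complex.continuous_ofReal.tendsto _).comp ?_
  rcases eq_or_ne p 0 with rfl | hp
  · simp
  have h1 : Tendsto (fun δ : Set.Ioi (0 : ℝ) => p / Real.sqrt (p ^ 2 + (m * δ.1⁻¹) ^ 2)) atTop
      (𝓝 (p / Real.sqrt (p ^ 2 + (m * 0) ^ 2))) := by
    refine Tendsto.div tendsto_const_nhds ?_ ?_
    · exact (Real.continuous_sqrt.tendsto _).comp
        (((tendsto_inv_Ioi.const_mul m).pow 2).const_add (p ^ 2))
    · rw [mul_zero]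
      have : 0 < p ^ 2 := by positivity
      simp [Real.sqrt_sq_eq_abs, hp]
  rw [mul_zero, zero_pow two_ne_zero, add_zero, Real.sqrt_sq_eq_abs] at h1
  refine h1.congr fun δ => ?_
  have hδ : 0 < δ.1 := δ.2
  have h2 : (δ.1 * p) ^ 2 + m ^ 2 = δ.1 ^ 2 * (p ^ 2 + (m * δ.1⁻¹) ^ 2) := by
    field_simp
  rw [h2, Real.sqrt_mul (sq_nonneg _), Real.sqrt_sq hδ.le, mul_div_mul_left _ _ hδ.ne']

theorem tendsto_dilConj_velocity (m : ℝ) (φ : H) :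
    Tendsto (fun δ => dilConj δ (velocity m) φ) atTop (𝓝 (signP φ)) :=
  tendsto_dilConj_funP _ _ _ _ tendsto_velocity φ

/-! ### The operator `i c + t P / |P|` -/

theorem signP_signP (φ : H) : signP (signP φ) = φ := by
  have hk : ∀ p : ℝ, ‖((p / |p| : ℝ) : ℂ) * ((p / |p| : ℝ) : ℂ)‖ ≤ 1 := fun p => by
    rw [norm_mul]
    exact mul_le_one₀ (norm_signum_le p) (norm_nonneg _) (norm_signum_le p)
  rw [signP, funP_funP _ _ _ _ (k := fun p => ((p / |p| : ℝ) : ℂ) * ((p / |p| : ℝ) : ℂ))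
    (by fun_prop) hk fun p => rfl]
  refine funP_eq_self _ _ (fun p hp => ?_) φ
  rw [← Complex.ofReal_mul, div_mul_div_comm, abs_mul_abs_self, div_self (mul_ne_zero hp hp),
    Complex.ofReal_one]

theorem isUnit_limitOp (t : ℝ) {c : ℝ} (hc : c ≠ 0) : IsUnit (limitOp t c) := by
  have hS : signP * signP = 1 := by
    ext1 φ
    exact signP_signP φ
  have h0 : (t ^ 2 + c ^ 2 : ℝ) ≠ 0 := by positivity
  have h0' : ((t : ℂ) ^ 2 + (c : ℂ) ^ 2) ≠ 0 := by exact_mod_cast h0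
  -- Since $S=P/|P|$ satisfies $S^2=1$, $(ic+tS)(-ic+tS)=c^2+t^2$.
  set X : H →L[ℂ] H := (-(Complex.I * (c : ℂ))) • (1 : H →L[ℂ] H) + (t : ℂ) • signP with hX
  have hI : Complex.I * c * -(Complex.I * c) + (t : ℂ) * t = (t : ℂ) ^ 2 + (c : ℂ) ^ 2 := by
    linear_combination (-(c : ℂ) ^ 2) * Complex.I_sq
  have h1 : limitOp t c * X = ((t : ℂ) ^ 2 + (c : ℂ) ^ 2) • (1 : H →L[ℂ] H) := by
    rw [limitOp, hX, ← hI]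
    simp only [add_mul, mul_add, smul_mul_smul_comm, hS, one_mul, mul_one]
    module
  have h2 : X * limitOp t c = ((t : ℂ) ^ 2 + (c : ℂ) ^ 2) • (1 : H →L[ℂ] H) := by
    rw [limitOp, hX, ← hI]
    simp only [add_mul, mul_add, smul_mul_smul_comm, hS, one_mul, mul_one]
    module
  refine ⟨⟨limitOp t c, ((t : ℂ) ^ 2 + (c : ℂ) ^ 2)⁻¹ • X, ?_, ?_⟩, rfl⟩
  · rw [mul_smul_comm, h1, smul_smul, inv_mul_cancel₀ h0', one_smul]
  · rw [smul_mul_assoc, h2, smul_smul, inv_mul_cancel₀ h0', one_smul]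

/-- Tested on the vector whose Fourier transform is the indicator of $(-1,1)$, a scalar would have
to be $1$ on $(0,1)$ and $-1$ on $(-1,0)$. -/
theorem signP_ne_smul_one (s : ℂ) : signP ≠ s • (1 : H →L[ℂ] H) := by
  intro hs
  set ψ : H := indicatorConstLp 2 (measurableSet_Ioo (a := (-1 : ℝ)) (b := 1)) (by simp) (1 : ℂ)
    with hψ
  set φ : H := (Lp.fourierTransformₗᵢ ℝ ℂ).symm ψ with hφ
  have h1 : 𝓕 φ = ψ := (Lp.fourierTransformₗᵢ ℝ ℂ).apply_symm_apply ψ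
  have h2 : 𝓕 (signP φ) = s • ψ := by
    rw [hs, ← h1]
    exact (Lp.fourierTransformₗᵢ ℝ ℂ).map_smul s φ
  have h3 : ∀ᵐ ξ : ℝ, ξ ∈ Set.Ioo (-1 : ℝ) 1 →
      ((2 * Real.pi * ξ / |2 * Real.pi * ξ| : ℝ) : ℂ) = s := by
    have h4 := fourier_funP (g := fun p => ((p / |p| : ℝ) : ℂ)) (by fun_prop) norm_signum_le φ
    change (𝓕 (signP φ) : H) =ᵐ[volume] _ at h4
    rw [h2, h1] at h4
    filter_upwards [h4, Lp.coeFn_smul s ψ,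
      indicatorConstLp_coeFn (p := 2) (hs := measurableSet_Ioo (a := (-1 : ℝ)) (b := 1))
        (hμs := by simp) (c := (1 : ℂ)) (μ := volume)] with ξ h5 h6 h7 hξ
    rw [h6, Pi.smul_apply, h7, Set.indicator_of_mem hξ, smul_eq_mul, mul_one, mul_one] at h5
    exact h5.symm
  have key : ∀ u v : ℝ, -1 ≤ u → v ≤ 1 → u < v → ∀ w : ℂ,
      (∀ ξ ∈ Set.Ioo u v, ((2 * Real.pi * ξ / |2 * Real.pi * ξ| : ℝ) : ℂ) = w) → s = w := by
    intro u v hu hv huv w hw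
    by_contra hne
    have h0 : volume (Set.Ioo u v) = 0 := by
      refine measure_mono_null (fun ξ hξ => ?_) (ae_iff.1 h3)
      intro hcon
      exact hne ((hcon ⟨hu.trans_lt hξ.1, hξ.2.trans_le hv⟩).symm.trans (hw ξ hξ))
    rw [Real.volume_Ioo, ENNReal.ofReal_eq_zero] at h0
    linarith
  have hp : s = 1 := key 0 1 (by norm_num) le_rfl one_pos 1 fun ξ hξ => by
    have : 0 < 2 * Real.pi * ξ := mul_pos Real.two_pi_pos hξ.1
    rw [abs_of_pos this, div_self this.ne', Complex.ofReal_one]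
  have hn : s = -1 := key (-1) 0 le_rfl zero_le_one (by norm_num) (-1) fun ξ hξ => by
    have : 2 * Real.pi * ξ < 0 := mul_neg_of_pos_of_neg Real.two_pi_pos hξ.2
    rw [abs_of_neg this, div_neg, div_self this.ne, Complex.ofReal_neg, Complex.ofReal_one]
  rw [hp] at hn
  norm_num at hn

theorem inverse_limitOp_ne_smul_one {t c : ℝ} (ht : t ≠ 0) (hc : c ≠ 0) (z : ℂ) :
    Ring.inverse (limitOp t c) ≠ z • (1 : H →L[ℂ] H) := by
  intro h
  have htC : (t : ℂ) ≠ 0 := by exact_mod_cast ht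
  have h1 := Ring.mul_inverse_cancel _ (isUnit_limitOp t hc)
  rw [h, mul_smul_comm, mul_one, limitOp, smul_add, smul_smul, smul_smul] at h1
  have hz : z ≠ 0 := by
    rintro rfl
    rw [zero_mul, zero_mul, zero_smul, zero_smul, add_zero] at h1
    exact zero_ne_one h1
  refine signP_ne_smul_one ((z * t)⁻¹ * (1 - z * (Complex.I * c))) ?_
  rw [mul_smul, eq_inv_smul_iff₀ (mul_ne_zero hz htC), sub_smul, one_smul]
  exact eq_sub_of_add_eq' h1

/-! ### The relativistic evolution on Schwartz functions -/

/-- `e^{i t H_m}` on the Schwartz space. -/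
noncomputable def schwartzEvolution (m t : ℝ) (f : 𝓢(ℝ, ℂ)) : 𝓢(ℝ, ℂ) :=
  𝓕⁻ (smulLeftCLM ℂ (fun ξ : ℝ => Complex.exp
    (((t * Real.sqrt ((2 * Real.pi * ξ) ^ 2 + m ^ 2) : ℝ) : ℂ) * Complex.I)) (𝓕 f))

theorem fourier_schwartzEvolution {m : ℝ} (hm : 0 < m) (t : ℝ) (f : 𝓢(ℝ, ℂ)) (ξ : ℝ) :
    𝓕 (schwartzEvolution m t f) ξ = Complex.exp
      (((t * Real.sqrt ((2 * Real.pi * ξ) ^ 2 + m ^ 2) : ℝ) : ℂ) * Complex.I) * 𝓕 f ξ := by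
  have hg : Function.HasTemperateGrowth
      (fun ξ : ℝ => t * Real.sqrt ((2 * Real.pi * ξ) ^ 2 + m ^ 2)) :=
    (Function.HasTemperateGrowth.const t).mul
      ((hasTemperateGrowth_sqrt hm).comp (hasTemperateGrowth_const_mul (2 * Real.pi)))
  rw [schwartzEvolution, FourierTransform.fourier_fourierInv_eq,
    smulLeftCLM_apply_apply (hasTemperateGrowth_phase hg), smul_eq_mul]

theorem relEvolution_ι {m : ℝ} (hm : 0 < m) (t : ℝ) (f : 𝓢(ℝ, ℂ)) :
    relEvolution m t (ι f) = ι (schwartzEvolution m t f) := by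
  apply eq_of_fourier_ae_eq
  rw [fourier_ι]
  have h1 := fourier_funP (g := fun p => Complex.exp
    (((t * Real.sqrt (p ^ 2 + m ^ 2) : ℝ) : ℂ) * Complex.I)) (by fun_prop) (norm_phase_le t m) (ι f)
  change (𝓕 (relEvolution m t (ι f)) : H) =ᵐ[volume] _ at h1
  rw [fourier_ι] at h1
  filter_upwards [h1, coeFn_ι (𝓕 f), coeFn_ι (𝓕 (schwartzEvolution m t f))] with ξ h1 h2 h3
  rw [h1, h2, h3, fourier_schwartzEvolution hm t f]

theorem relEvolution_relEvolution (m : ℝ) {s t : ℝ} (h : s + t = 0) (φ : H) :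
    relEvolution m s (relEvolution m t φ) = φ := by
  rw [relEvolution, relEvolution, funP_funP _ _ _ _ (k := fun _ => 1) measurable_const (K := 1)
    (by simp) fun p => ?_]
  · exact funP_eq_self _ _ (fun _ _ => rfl) φ
  · rw [← Complex.exp_add, ← add_mul, ← Complex.ofReal_add, ← add_mul, h]
    simp

theorem schwartzEvolution_schwartzEvolution {m : ℝ} (hm : 0 < m) {s t : ℝ} (h : s + t = 0)
    (f : 𝓢(ℝ, ℂ)) : schwartzEvolution m s (schwartzEvolution m t f) = f := by
  apply injective_toLp 2 (volume : Measure ℝ)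
  change ι _ = ι f
  rw [← relEvolution_ι hm, ← relEvolution_ι hm, relEvolution_relEvolution m h]

theorem fourier_schwartzQ (f : 𝓢(ℝ, ℂ)) (ξ : ℝ) :
    deriv (𝓕 f : 𝓢(ℝ, ℂ)) ξ = -(2 * Real.pi * Complex.I) * 𝓕 (schwartzQ f) ξ := by
  have h := lineDerivOp_fourier_eq f (1 : ℝ)
  have h2 : (smulLeftCLM ℂ (inner ℝ · (1 : ℝ)) f : 𝓢(ℝ, ℂ)) = schwartzQ f := by
    ext x
    rw [smulLeftCLM_apply_apply (Function.hasTemperateGrowth_inner_left 1), schwartzQ_apply]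
    simp
  rw [h2, FourierTransform.fourier_smul] at h
  have h3 := DFunLike.congr_fun h ξ
  rw [lineDerivOp_apply_eq_fderiv, fderiv_apply_one_eq_deriv] at h3
  exact h3

/-- In momentum space $Q$ acts as $(i/2\pi)\,d/d\xi$. By the product rule, the derivative of the
phase $t\sqrt{(2\pi\xi)^2+m^2}$ produces exactly the velocity term. -/
theorem boosted_schwartzEvolution {m : ℝ} (hm : 0 < m) (t : ℝ) (f : 𝓢(ℝ, ℂ)) :
    (t : ℂ) • velocity m (ι (schwartzEvolution m t f)) + ι (schwartzQ (schwartzEvolution m t f)) =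
      ι (schwartzEvolution m t (schwartzQ f)) := by
  apply eq_of_fourier_ae_eq
  set F := schwartzEvolution m t f with hF
  have h0 : 𝓕 ((t : ℂ) • velocity m (ι F) + ι (schwartzQ F)) =
      (t : ℂ) • 𝓕 (velocity m (ι F)) + ι (𝓕 (schwartzQ F)) := by
    rw [FourierTransform.fourier_add, FourierTransform.fourier_smul, fourier_ι]
  rw [h0, fourier_ι]
  have h1 := fourier_funP (g := fun p => ((p / Real.sqrt (p ^ 2 + m ^ 2) : ℝ) : ℂ)) (by fun_prop)
    (norm_velocity_le m) (ι F)
  change (𝓕 (velocity m (ι F)) : H) =ᵐ[volume] _ at h1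
  rw [fourier_ι] at h1
  filter_upwards [h1, coeFn_ι (𝓕 F), coeFn_ι (𝓕 (schwartzQ F)),
    coeFn_ι (𝓕 (schwartzEvolution m t (schwartzQ f))),
    Lp.coeFn_add ((t : ℂ) • 𝓕 (velocity m (ι F))) (ι (𝓕 (schwartzQ F))),
    Lp.coeFn_smul (t : ℂ) (𝓕 (velocity m (ι F)))] with ξ h1 h2 h3 h4 h5 h6
  rw [h5, Pi.add_apply, h6, Pi.smul_apply, h1, h2, h3, h4, fourier_schwartzEvolution hm t (schwartzQ f)]
  have hpos : 0 < (2 * Real.pi * ξ) ^ 2 + m ^ 2 := by positivity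
  have hω : HasDerivAt (fun ξ : ℝ => t * Real.sqrt ((2 * Real.pi * ξ) ^ 2 + m ^ 2))
      (2 * Real.pi * (t * (2 * Real.pi * ξ / Real.sqrt ((2 * Real.pi * ξ) ^ 2 + m ^ 2)))) ξ := by
    have ha : HasDerivAt (fun ξ : ℝ => (2 * Real.pi * ξ) ^ 2 + m ^ 2)
        (2 * (2 * Real.pi * ξ) * (2 * Real.pi)) ξ := by
      have := (((hasDerivAt_id ξ).const_mul (2 * Real.pi)).pow 2).add_const (m ^ 2)
      convert! this using 1
      simp
    have hb := (ha.sqrt hpos.ne').const_mul t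
    convert! hb using 1
    field_simp
  have hd := (((hω.ofReal_comp.mul_const Complex.I).cexp).mul
    ((𝓕 f : 𝓢(ℝ, ℂ)).hasDerivAt ξ)).congr_of_eventuallyEq
      (f₁ := (𝓕 F : 𝓢(ℝ, ℂ))) (Eventually.of_forall fun y => fourier_schwartzEvolution hm t f y)
  have hQF := fourier_schwartzQ F ξ
  rw [hd.deriv, fourier_schwartzQ f ξ] at hQF
  rw [hF, fourier_schwartzEvolution hm t f, ← hF, smul_eq_mul]
  have hne : (2 * Real.pi * Complex.I : ℂ) ≠ 0 := by simp [Real.pi_ne_zero]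
  apply mul_left_cancel₀ (neg_ne_zero.2 hne)
  rw [mul_add, ← hQF]
  push_cast
  ring

/-! ### The evolved resolvent -/

theorem schwartzComb_zero_one (f : 𝓢(ℝ, ℂ)) : schwartzComb 0 1 f = schwartzQ f := by
  ext x
  rw [schwartzComb_apply, schwartzQ_apply]
  simp

/-- The evolution permutes the Schwartz functions and intertwines $ic+Q$ with the shifted
`boostedQ`, so the criterion for closures applies to the conjugate. Uniqueness of bounded inverses
then gives the conjugation formula. -/
theorem isBoundedInverse_conj {m : ℝ} (hm : 0 < m) (t : ℝ) {c : ℝ} (hc : c ≠ 0) :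
    IsBoundedInverse (shiftedClosure c (boostedQ m t))
      (relEvolution m t * basicResolvent 0 1 c * relEvolution m (-t)) := by
  have hG : ∀ f, (Complex.I * (c : ℂ)) • ι (schwartzEvolution m t f) +
      ((t : ℂ) • velocity m (ι (schwartzEvolution m t f)) +
        ι (schwartzQ (schwartzEvolution m t f))) =
      relEvolution m t (ι ((Complex.I * (c : ℂ)) • f + schwartzComb 0 1 f)) := by
    intro f
    rw [boosted_schwartzEvolution hm, schwartzComb_zero_one, map_add, map_add, map_smul, map_smul,
      relEvolution_ι hm, relEvolution_ι hm]
  have hinv (f : 𝓢(ℝ, ℂ)) : schwartzEvolution m t (schwartzEvolution m (-t) f) = f :=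
    schwartzEvolution_schwartzEvolution hm (add_neg_cancel t) f
  refine isBoundedInverse_shiftedClosure (hasSchwartzGraph_boostedQ m t) (fun η hη => ?_)
    (fun g => ?_) ?_
  · have h1 : relEvolution m t (basicResolvent 0 1 c (relEvolution m (-t) η)) = 0 := hη
    have h2 := congrArg (relEvolution m (-t)) h1
    rw [relEvolution_relEvolution m (neg_add_cancel t), map_zero] at h2
    have h3 := (isBoundedInverse_basicResolvent 0 1 hc).injective h2
    rw [← relEvolution_relEvolution m (add_neg_cancel t) η, h3, map_zero]
  · rw [← hinv g, hG]
    change relEvolution m t (basicResolvent 0 1 c (relEvolution m (-t) (relEvolution m t _))) = _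
    rw [relEvolution_relEvolution m (neg_add_cancel t), basicResolvent_apply 0 1 hc,
      relEvolution_ι hm]
  · refine Dense.mono ?_ denseRange_ι
    rintro _ ⟨h, rfl⟩
    obtain ⟨f, hf⟩ := exists_shift_schwartzComb_eq hc 0 1 (schwartzEvolution m (-t) h)
    refine ⟨schwartzEvolution m t f, ?_⟩
    change (Complex.I * (c : ℂ)) • ι (schwartzEvolution m t f) +
      ((t : ℂ) • velocity m (ι (schwartzEvolution m t f)) +
        ι (schwartzQ (schwartzEvolution m t f))) = _
    rw [hG, hf, relEvolution_ι hm, hinv]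

theorem isBoundedInverse_evolvedResolvent {m : ℝ} (hm : 0 < m) (t : ℝ) {c : ℝ} (hc : c ≠ 0) :
    IsBoundedInverse (shiftedClosure c (boostedQ m t)) (evolvedResolvent m t c) :=
  (isBoundedInverse_conj hm t hc).boundedInverse

theorem conj_eq_evolvedResolvent {m : ℝ} (hm : 0 < m) (t : ℝ) {c : ℝ} (hc : c ≠ 0) :
    relEvolution m t * basicResolvent 0 1 c * relEvolution m (-t) = evolvedResolvent m t c :=
  (isBoundedInverse_conj hm t hc).unique (isBoundedInverse_evolvedResolvent hm t hc)

theorem dilConj_evolvedResolvent_apply {m : ℝ} (hm : 0 < m) (t : ℝ) {c : ℝ} (hc : c ≠ 0)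
    (δ : Set.Ioi (0 : ℝ)) (f : 𝓢(ℝ, ℂ)) :
    dilConj δ (evolvedResolvent m t c) ((Complex.I * (c : ℂ)) • ι f +
      ((t : ℂ) • dilConj δ (velocity m) (ι f) + ((δ.1⁻¹ : ℝ) : ℂ) • ι (schwartzQ f))) = ι f := by
  have hQ : ι (schwartzQ (dilS (invIoi δ) f)) =
      (dilation δ).symm (((δ.1⁻¹ : ℝ) : ℂ) • ι (schwartzQ f)) := by
    have h := schwartzComb_dilS 0 1 (invIoi δ) f
    rw [← schwartzComb_zero_one, h, ← map_smul ι, dilation_ι_symm]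
    congr 2
    ext x
    change _ = ((δ.1⁻¹ : ℝ) : ℂ) * schwartzQ f x
    rw [schwartzComb_apply, schwartzQ_apply]
    simp [invIoi]
  have h := (isBoundedInverse_evolvedResolvent hm t hc).apply_schwartz
    (hasSchwartzGraph_boostedQ m t) (dilS (invIoi δ) f)
  rw [dilConj_apply, dilConj_apply, map_add (dilation δ).symm, map_add (dilation δ).symm,
    map_smul (dilation δ).symm, map_smul (dilation δ).symm (t : ℂ),
    LinearIsometryEquiv.symm_apply_apply, ← hQ, dilation_ι_symm, h, dilation_dilS_invIoi]

/-- Let $L=ic+tP/|P|$, $R_\delta$ the conjugated resolvent and $v_\delta$ the conjugated velocity.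
On the dense set of vectors $Lf$, the resolvent identity gives $R_\delta
Lf=f-R_\delta\bigl(t(v_\delta-P/|P|)f+\delta^{-1}Qf\bigr)\to f=L^{-1}(Lf)$. -/
theorem hasDilationLimit_evolvedResolvent {m : ℝ} (hm : 0 < m) (t : ℝ) {c : ℝ} (hc : c ≠ 0) :
    HasDilationLimit (evolvedResolvent m t c) (Ring.inverse (limitOp t c)) := by
  have hu := isUnit_limitOp t hc
  have hsurj : Function.Surjective (limitOp t c) := fun y =>
    ⟨Ring.inverse (limitOp t c) y, congrArg (fun A : H →L[ℂ] H => A y)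
      (Ring.mul_inverse_cancel _ hu)⟩
  refine hasDilationLimit_of_denseRange
    (hsurj.denseRange.comp denseRange_ι (limitOp t c).continuous) fun f => ?_
  have hB : Ring.inverse (limitOp t c) ((limitOp t c ∘ ι) f) = ι f :=
    congrArg (fun A : H →L[ℂ] H => A (ι f)) (Ring.inverse_mul_cancel _ hu)
  rw [hB]
  have h1 : Tendsto (fun δ : Set.Ioi (0 : ℝ) =>
      (t : ℂ) • (dilConj δ (velocity m) (ι f) - signP (ι f)) +
        ((δ.1⁻¹ : ℝ) : ℂ) • ι (schwartzQ f)) atTop (𝓝 0) := by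
    have ha := ((tendsto_dilConj_velocity m (ι f)).sub_const (signP (ι f))).const_smul (t : ℂ)
    have hb := tendsto_inv_Ioi_complex.smul_const (ι (schwartzQ f))
    simpa only [sub_self, smul_zero, zero_smul, add_zero] using ha.add hb
  have h2 := (tendsto_dilConj_zero (evolvedResolvent m t c) h1).const_sub (ι f)
  rw [sub_zero] at h2
  refine h2.congr fun δ => ?_
  have h3 := dilConj_evolvedResolvent_apply hm t hc δ f
  rw [sub_eq_iff_eq_add, ← map_add]
  refine h3.symm.trans (congrArg _ ?_)
  change _ = ((Complex.I * (c : ℂ)) • ι f + (t : ℂ) • signP (ι f)) + _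
  rw [smul_sub]
  abel

theorem evolvedResolvent_notMem {m t c : ℝ} (hm : 0 < m) (ht : t ≠ 0) (hc : c ≠ 0) :
    evolvedResolvent m t c ∉ resolventAlgebra := by
  intro h
  obtain ⟨z, hz⟩ := exists_scalar_dilationLimit h
  exact inverse_limitOp_ne_smul_one ht hc z
    ((hasDilationLimit_evolvedResolvent hm t hc).unique hz)

theorem basicResolvent_mem (a b : ℝ) {c : ℝ} (hc : c ≠ 0) :
    basicResolvent a b c ∈ resolventAlgebra :=
  StarSubalgebra.le_topologicalClosure _
    (StarAlgebra.subset_adjoin ℂ _ ⟨a, b, c, hc, rfl⟩)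

end ResolventAlgebra

theorem lemma6p5 :
    -- dilation limits of the basic resolvents
    (∀ a b c : ℝ, c ≠ 0 →
      IsBoundedInverse (shiftedClosure c (linComb a b)) (basicResolvent a b c) ∧
      HasDilationLimit (basicResolvent a b c)
        (if a = 0 then (Complex.I * (c : ℂ))⁻¹ • (1 : H →L[ℂ] H) else 0)) ∧
    -- all elements of the resolvent algebra have scalar dilation limits
    (∀ A ∈ resolventAlgebra, ∃ z : ℂ, HasDilationLimit A (z • (1 : H →L[ℂ] H))) ∧
    -- the dilation limit of the evolved resolvent of the position operator
    (∀ m t c : ℝ, 0 < m → c ≠ 0 →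
      IsBoundedInverse (shiftedClosure c (boostedQ m t)) (evolvedResolvent m t c) ∧
      IsUnit (limitOp t c) ∧
      HasDilationLimit (evolvedResolvent m t c) (Ring.inverse (limitOp t c))) ∧
    -- this limit is not a scalar
    (∀ t c : ℝ, t ≠ 0 → c ≠ 0 → ∀ z : ℂ, Ring.inverse (limitOp t c) ≠ z • (1 : H →L[ℂ] H)) ∧
    -- the evolved resolvent leaves the resolvent algebra
    (∀ m t c : ℝ, 0 < m → c ≠ 0 →
      relEvolution m t * basicResolvent 0 1 c * relEvolution m (-t) = evolvedResolvent m t c ∧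
      (t ≠ 0 → evolvedResolvent m t c ∉ resolventAlgebra)) ∧
    -- the relativistic evolution does not leave the resolvent algebra invariant
    (∀ m t : ℝ, 0 < m → t ≠ 0 →
      ¬ ∀ A ∈ resolventAlgebra, relEvolution m t * A * relEvolution m (-t) ∈ resolventAlgebra) := by

  refine ⟨fun a b c hc => ⟨isBoundedInverse_basicResolvent a b hc, ?_⟩,
    fun A hA => exists_scalar_dilationLimit hA,
    fun m t c hm hc => ⟨isBoundedInverse_evolvedResolvent hm t hc, isUnit_limitOp t hc,
      hasDilationLimit_evolvedResolvent hm t hc⟩,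
    fun t c ht hc z => inverse_limitOp_ne_smul_one ht hc z,
    fun m t c hm hc => ⟨conj_eq_evolvedResolvent hm t hc,
      fun ht => evolvedResolvent_notMem hm ht hc⟩,
    fun m t hm ht h => ?_⟩
  · split_ifs with ha
    · subst ha
      exact hasDilationLimit_basicResolvent_zero b hc
    · exact hasDilationLimit_basicResolvent_of_ne ha b hc
  -- The element driven out of the algebra is $R(0,1,1)=(i+Q)^{-1}$.
  · refine evolvedResolvent_notMem hm ht one_ne_zero ?_
    rw [← conj_eq_evolvedResolvent hm t one_ne_zero]
    exact h _ (basicResolvent_mem 0 1 one_ne_zero)
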